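/- Let $n\ge 1$ be an integer, $t,s\in\mathbb{R}$ and $p\in[1,2]$. Use the unitary Fourier transform $\hat f(\xi)=\mathcal{F}f(\xi)=(2\pi)^{-n/2}\int_{\mathbb{R}^n}e^{-ix\cdot\xi}f(x)\,dx$, extended to the tempered distributions $\mathcal{S}'(\mathbb{R}^n)$, and write $\langle\xi\rangle=\sqrt{1+|\xi|^2}$. Let $H^s(\mathbb{R}^n)=\{u\in\mathcal{S}'(\mathbb{R}^n):\mathcal{F}^{-1}(\langle\cdot\rangle^s\hat u)\in L^2(\mathbb{R}^n)\}$ with norm $\|u\|_{H^s}=\|\langle\cdot\rangle^s\hat u\|_2$, and for $u\in\mathcal{S}'(\mathbb{R}^n)$ let $\|u\|_{H^{t,p}}=\|\mathcal{F}^{-1}(\langle\cdot\rangle^t\hat u)\|_p$, understood as $\infty$ if $\mathcal{F}^{-1}(\langle\cdot\rangle^t\hat u)\notin L^p(\mathbb{R}^n)$. Let $\mathcal{F}^s(\mathbb{R}^n)$ be the group, under composition, of all additive (not necessarily linear) bijections $P:H^s(\mathbb{R}^n)\to H^s(\mathbb{R}^n)$ such that $|\widehat{Pf}|=|\hat f|$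 almost everywhere for every $f\in H^s(\mathbb{R}^n)$, and let $G$ be a subgroup of $\mathcal{F}^s(\mathbb{R}^n)$. For $f,g\in H^s(\mathbb{R}^n)$ put $$d([f],[g])=\inf_{P\in G}\|f-Pg\|_{H^s},\qquad A_{f\cap g}=\operatorname{supp}(\hat f)\cap\operatorname{supp}(\hat g),$$ where the supports are those of distributions, and let $c_{n,p}=\|\mathcal{F}\|^2_{L^p(\mathbb{R}^n)\to L^{p/(p-1)}(\mathbb{R}^n)}$; here $\frac{1}{1-1}=\frac{2}{2-2}=\infty$ and $0\cdot\infty=0$. Then $c_{n,p}\le 1$, and for all $f,g\in H^s(\mathbb{R}^n)$ $$d([f],[g])^2\le\big\|\langle\xi\rangle^s(|\hat f|-|\hat g|)\big\|_2^2+c_{n,p}\,\big\|\chi_{A_{f\cap g}}\langle\xi\rangle^{2s-2t}\big\|_{\frac{p}{2-p}}\,\inf_{P,Q\in G}\|Pf-Qg\|_{H^{t,p}}^2 .$$ Moreover, the constant $\|\chi_{A_{f\cap g}}\langle\xi\rangle^{2s-2t}\|_{\frac{p}{2-p}}$ is finite if one of the following conditions holds: (i) $A_{f\cap g}$ is compact;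 (ii) $A_{f\cap g}$ has finite measure and $s\le t$; (iii) $s<t-n\left(\frac1p-\frac12\right)$. -/

import Mathlib

open MeasureTheory FourierTransform Distribution
open scoped ENNReal SchwartzMap

noncomputable section

namespace FourierPhase

/-- The Euclidean space `ℝⁿ` with its Euclidean norm and Lebesgue measure. -/
abbrev Rn (n : ℕ) : Type := EuclideanSpace ℝ (Fin n)

/-- The Japanese bracket `⟨ξ⟩ = √(1 + |ξ|²)`. -/
def bracket {n : ℕ} (ξ : Rn n) : ℝ := Real.sqrt (1 + ‖ξ‖ ^ 2)

theorem bracket_rpow {n : ℕ} (t : ℝ) (ξ : Rn n) :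
    bracket ξ ^ t = (1 + ‖ξ‖ ^ 2) ^ (t / 2) := by
  rw [bracket, Real.sqrt_eq_rpow, ← Real.rpow_mul (by positivity)]
  congr 1
  ring

/-- Powers of `⟨ξ⟩` may multiply tempered distributions. -/
theorem hasTemperateGrowth_bracket_rpow (n : ℕ) (t : ℝ) :
    (fun ξ : Rn n => ((bracket ξ ^ t : ℝ) : ℂ)).HasTemperateGrowth := by
  simp only [bracket_rpow]
  fun_prop

/-- The dilation `x ↦ (2π)⁻¹ x` of `ℝⁿ`. -/
def dilation (n : ℕ) : Rn n ≃L[ℝ] Rn n :=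
  ContinuousLinearEquiv.smulLeft (Units.mk0 (2 * Real.pi)⁻¹ (by positivity))

/-- The normalizing factor `(2π)^{-n/2}`. -/
def normFactor (n : ℕ) : ℂ := (((2 * Real.pi) ^ (-(n : ℝ) / 2) : ℝ) : ℂ)

/-- The unitary Fourier transform `φ̂(ξ) = (2π)^{-n/2} ∫ e^{-i x·ξ} φ(x) dx` of Schwartz functions;
see `schwartzFourier_apply`. -/
def schwartzFourier (n : ℕ) : 𝓢(Rn n, ℂ) →L[ℂ] 𝓢(Rn n, ℂ) :=
  normFactor n • (SchwartzMap.compCLMOfContinuousLinearEquiv ℂ (dilation n) ∘L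
    fourierCLM ℂ 𝓢(Rn n, ℂ))

/-- The inverse transform `φ ↦ (2π)^{-n/2} ∫ e^{i x·ξ} φ(ξ) dξ` of Schwartz functions;
see `schwartzFourierInv_apply`. -/
def schwartzFourierInv (n : ℕ) : 𝓢(Rn n, ℂ) →L[ℂ] 𝓢(Rn n, ℂ) :=
  normFactor n • (SchwartzMap.compCLMOfContinuousLinearEquiv ℂ (dilation n) ∘L
    fourierInvCLM ℂ 𝓢(Rn n, ℂ))

theorem schwartzFourier_apply {n : ℕ} (φ : 𝓢(Rn n, ℂ)) (ξ : Rn n) :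
    schwartzFourier n φ ξ =
      normFactor n * ∫ x, Complex.exp (-(Complex.I * (inner ℝ x ξ : ℝ))) * φ x := by
  have h : schwartzFourier n φ ξ = normFactor n * (𝓕 (φ : Rn n → ℂ)) ((2 * Real.pi)⁻¹ • ξ) := rfl
  rw [h, Real.fourier_eq']
  congr 2
  ext x
  rw [smul_eq_mul, inner_smul_right]
  congr 2
  push_cast
  have : (Real.pi : ℂ) ≠ 0 := by exact_mod_cast Real.pi_ne_zero
  field_simp

theorem schwartzFourierInv_apply {n : ℕ} (φ : 𝓢(Rn n, ℂ)) (x : Rn n) :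
    schwartzFourierInv n φ x =
      normFactor n * ∫ ξ, Complex.exp (Complex.I * (inner ℝ ξ x : ℝ)) * φ ξ := by
  have h : schwartzFourierInv n φ x =
      normFactor n * (𝓕⁻ φ : 𝓢(Rn n, ℂ)) ((2 * Real.pi)⁻¹ • x) := rfl
  rw [h, SchwartzMap.fourierInv_coe, Real.fourierInv_eq']
  congr 2
  ext ξ
  rw [smul_eq_mul, inner_smul_right]
  congr 2
  push_cast
  have : (Real.pi : ℂ) ≠ 0 := by exact_mod_cast Real.pi_ne_zero
  field_simp

/-- The Fourier transform of tempered distributions, `û(φ) = u(φ̂)`. -/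
def fourier (n : ℕ) : 𝓢'(Rn n, ℂ) →L[ℂ] 𝓢'(Rn n, ℂ) :=
  PointwiseConvergenceCLM.precomp ℂ (schwartzFourier n)

/-- The inverse Fourier transform of tempered distributions. -/
def fourierInv (n : ℕ) : 𝓢'(Rn n, ℂ) →L[ℂ] 𝓢'(Rn n, ℂ) :=
  PointwiseConvergenceCLM.precomp ℂ (schwartzFourierInv n)

/-- The product `⟨·⟩^t u` with a tempered distribution `u`. -/
def bracketMul (n : ℕ) (t : ℝ) : 𝓢'(Rn n, ℂ) →L[ℂ] 𝓢'(Rn n, ℂ) :=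
  TemperedDistribution.smulLeftCLM ℂ (fun ξ : Rn n => ((bracket ξ ^ t : ℝ) : ℂ))

/-- The tempered distribution `u` is given by integration against the function `v`. -/
def IsRepresentedBy {n : ℕ} (u : 𝓢'(Rn n, ℂ)) (v : Rn n → ℂ) : Prop :=
  LocallyIntegrable v volume ∧
    ∀ φ : 𝓢(Rn n, ℂ), Integrable (fun x => φ x * v x) volume ∧ u φ = ∫ x, φ x * v x

/-- The tempered distribution `u` belongs to `L^q(ℝⁿ)`. -/
def IsLp {n : ℕ} (q : ℝ≥0∞) (u : 𝓢'(Rn n, ℂ)) : Prop :=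
  ∃ v : Rn n → ℂ, IsRepresentedBy u v ∧ MemLp v q volume

/-- The `L^q` norm of a tempered distribution: the `L^q` norm of the (a.e. unique) function that
represents it, and `∞` if there is none. -/
def lpNorm {n : ℕ} (q : ℝ≥0∞) (u : 𝓢'(Rn n, ℂ)) : ℝ≥0∞ :=
  ⨅ (v : Rn n → ℂ) (_ : IsRepresentedBy u v), eLpNorm v q volume

/-- The Bessel potential norm `‖u‖_{H^{t,p}} = ‖𝓕⁻¹(⟨·⟩^t û)‖_p`, equal to `∞` if `u ∉ H^{t,p}`. -/
def besselNorm {n : ℕ} (t : ℝ) (p : ℝ≥0∞) (u : 𝓢'(Rn n, ℂ)) : ℝ≥0∞ :=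
  lpNorm p (fourierInv n (bracketMul n t (fourier n u)))

/-- The norm `‖u‖_{H^s} = ‖⟨·⟩^s û‖_2`. -/
def sobolevNorm {n : ℕ} (s : ℝ) (u : 𝓢'(Rn n, ℂ)) : ℝ≥0∞ :=
  lpNorm 2 (bracketMul n s (fourier n u))

theorem IsRepresentedBy.add {n : ℕ} {u₁ u₂ : 𝓢'(Rn n, ℂ)} {v₁ v₂ : Rn n → ℂ}
    (h₁ : IsRepresentedBy u₁ v₁) (h₂ : IsRepresentedBy u₂ v₂) :
    IsRepresentedBy (u₁ + u₂) (v₁ + v₂) := by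
  refine ⟨h₁.1.add h₂.1, fun φ => ?_⟩
  have e : (fun x => φ x * (v₁ + v₂) x) = fun x => φ x * v₁ x + φ x * v₂ x := by
    ext x
    simp [mul_add]
  rw [e]
  refine ⟨(h₁.2 φ).1.add (h₂.2 φ).1, ?_⟩
  rw [integral_add (h₁.2 φ).1 (h₂.2 φ).1, ← (h₁.2 φ).2, ← (h₂.2 φ).2]
  rfl

theorem IsRepresentedBy.smul {n : ℕ} (c : ℂ) {u : 𝓢'(Rn n, ℂ)} {v : Rn n → ℂ}
    (h : IsRepresentedBy u v) : IsRepresentedBy (c • u) (c • v) := by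
  refine ⟨h.1.smul c, fun φ => ?_⟩
  have e : (fun x => φ x * (c • v) x) = fun x => c * (φ x * v x) := by
    ext x
    simp only [Pi.smul_apply, smul_eq_mul]
    ring
  rw [e]
  refine ⟨(h.2 φ).1.const_mul c, ?_⟩
  rw [integral_const_mul, ← (h.2 φ).2]
  rfl

theorem isRepresentedBy_zero (n : ℕ) : IsRepresentedBy (0 : 𝓢'(Rn n, ℂ)) 0 := by
  refine ⟨locallyIntegrable_zero, fun φ => ?_⟩
  simp

/-- The Sobolev space `H^s(ℝⁿ) = {u ∈ 𝓢'(ℝⁿ) : 𝓕⁻¹(⟨·⟩^s û) ∈ L²(ℝⁿ)}`. -/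
def Hs (n : ℕ) (s : ℝ) : Submodule ℂ 𝓢'(Rn n, ℂ) where
  carrier := {u | IsLp 2 (fourierInv n (bracketMul n s (fourier n u)))}
  add_mem' := by
    rintro a b ⟨v, hv, hv'⟩ ⟨w, hw, hw'⟩
    refine ⟨v + w, ?_, hv'.add hw'⟩
    simpa only [map_add] using hv.add hw
  zero_mem' := by
    refine ⟨0, ?_, MemLp.zero⟩
    simpa only [map_zero] using isRepresentedBy_zero n
  smul_mem' := by
    rintro c a ⟨v, hv, hv'⟩
    refine ⟨c • v, ?_, hv'.const_smul c⟩
    simpa only [map_smul] using hv.smul c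

open Classical in
/-- The Fourier transform `û` as a function, determined up to a null set, for a tempered
distribution `u` whose Fourier transform is a function, in particular for every `u ∈ H^s(ℝⁿ)`
(the value `0` in the remaining cases is never used). -/
def hat {n : ℕ} (u : 𝓢'(Rn n, ℂ)) : Rn n → ℂ :=
  if h : ∃ v : Rn n → ℂ, IsRepresentedBy (fourier n u) v then h.choose else 0

/-- The group (under composition) of the additive bijections `P` of `H^s(ℝⁿ)` with
`|(Pf)^| = |f̂|` almost everywhere for every `f ∈ H^s(ℝⁿ)`. -/
def phaseGroup (n : ℕ) (s : ℝ) : Subgroup (Equiv.Perm (Hs n s)) where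
  carrier := {P | (∀ f g : Hs n s, P (f + g) = P f + P g) ∧
    ∀ f : Hs n s, ∀ᵐ ξ : Rn n, ‖hat (f : 𝓢'(Rn n, ℂ)) ξ‖ = ‖hat (P f : 𝓢'(Rn n, ℂ)) ξ‖}
  mul_mem' := by
    rintro P Q ⟨hP, hP'⟩ ⟨hQ, hQ'⟩
    refine ⟨fun f g => by simp [hP, hQ], fun f => ?_⟩
    filter_upwards [hQ' f, hP' (Q f)] with ξ h₁ h₂
    rw [h₁, h₂]
    rfl
  one_mem' := ⟨fun _ _ => rfl, fun _ => Filter.Eventually.of_forall fun _ => rfl⟩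
  inv_mem' := by
    rintro P ⟨hP, hP'⟩
    refine ⟨fun f g => ?_, fun f => ?_⟩
    · apply P.injective
      simp [hP]
    · filter_upwards [hP' (P⁻¹ f)] with ξ h
      rw [h]
      simp

/-- The quotient distance `d([f],[g]) = inf_{P ∈ G} ‖f - P g‖_{H^s}`. -/
def quotDist {n : ℕ} {s : ℝ} (G : Subgroup (Equiv.Perm (Hs n s))) (f g : Hs n s) : ℝ≥0∞ :=
  ⨅ P ∈ G, sobolevNorm s ((f - P g : Hs n s) : 𝓢'(Rn n, ℂ))

/-- `supp f̂ ∩ supp ĝ`, with supports in the sense of distributions. -/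
def suppInter {n : ℕ} (f g : 𝓢'(Rn n, ℂ)) : Set (Rn n) :=
  dsupport (fourier n f) ∩ dsupport (fourier n g)

/-- The weight constant `‖χ_A ⟨ξ⟩^{2s-2t}‖_{p/(2-p)}`. In `ℝ≥0∞` one has `2 / (2 - 2) = ∞`. -/
def weightConst {n : ℕ} (A : Set (Rn n)) (s t : ℝ) (p : ℝ≥0∞) : ℝ≥0∞ :=
  eLpNorm (A.indicator fun ξ => bracket ξ ^ (2 * s - 2 * t)) (p / (2 - p)) volume

/-- `c_{n,p}`, the square of the operator norm of the Fourier transform from `L^p(ℝⁿ)` to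
`L^{p/(p-1)}(ℝⁿ)`. In `ℝ≥0∞` one has `1 / (1 - 1) = ∞`. -/
def fourierConst (n : ℕ) (p : ℝ≥0∞) : ℝ≥0∞ :=
  (sInf {C : ℝ≥0∞ | ∀ u : 𝓢'(Rn n, ℂ), IsLp p u →
    lpNorm (p / (p - 1)) (fourier n u) ≤ C * lpNorm p u}) ^ 2

end FourierPhase

end

open FourierPhase

/-
Elements of `G` act isometrically on `H^s`, so `d([f],[g]) ≤ ‖Pf - Qg‖_{H^s}` for `P, Q ∈ G`. Since
`|(Pf)^| = |f̂|` and `|(Qg)^| = |ĝ|`, outside `A_{f∩g}` one of the two transforms vanishes and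
`|(Pf - Qg)^| = ||f̂| - |ĝ||`. On `A_{f∩g}`, Hölder's inequality with the weight `⟨ξ⟩^{2s-2t}`
followed by the definition of `c_{n,p}` bounds the remaining part of the norm by the Bessel norm of
`Pf - Qg`. If the infimum over `P, Q` is `0` while the weight is infinite, a minimizing sequence has
`(P_k f - Q_k g)^ → 0` almost everywhere along a subsequence, and dominated convergence with
majorant `⟨ξ⟩^s (|f̂| + |ĝ|)` gives `d([f],[g]) = 0`.

The bound `c_{n,p} ≤ 1` is the Hausdorff–Young inequality: the three lines theorem, applied to the
pairing of `𝓕 f` and `g` for simple `f`, `g` whose moduli are raised to complex powers, gives the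
bound for simple functions; `L^p`–`L^q` duality and density then extend it to `L^p`.
-/

open Complex.HadamardThreeLines

noncomputable section

namespace FourierPhase

/-! ### The Riesz–Thorin theorem for bilinear forms on simple functions -/

section RieszThorin

theorem bddAbove_norm_sum_mul_cexp {ι : Type*} (s : Finset ι) (c : ι → ℂ) (a b : ι → ℝ) :
    BddAbove ((norm ∘ fun z => ∑ i ∈ s, c i * Complex.exp (a i + b i * z)) ''
      verticalClosedStrip 0 1) := by
  have hcont : Continuous fun x : ℝ => ∑ i ∈ s, ‖c i‖ * Real.exp (a i + b i * x) := by fun_prop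
  obtain ⟨C, hC⟩ := (isCompact_Icc (a := (0 : ℝ)) (b := 1)).bddAbove_image hcont.continuousOn
  refine ⟨C, ?_⟩
  rintro _ ⟨z, hz, rfl⟩
  calc ‖∑ i ∈ s, c i * Complex.exp (a i + b i * z)‖
      ≤ ∑ i ∈ s, ‖c i * Complex.exp (a i + b i * z)‖ := norm_sum_le _ _
    _ = ∑ i ∈ s, ‖c i‖ * Real.exp (a i + b i * z.re) := by simp [Complex.norm_exp]
    _ ≤ C := hC ⟨z.re, hz, rfl⟩

theorem enorm_sum_mul_cexp_le_interp {ι : Type*} {s : Finset ι} {c : ι → ℂ} {a b : ι → ℝ}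
    {A B : ℝ≥0∞} (hA : A ≠ ∞) (hB : B ≠ ∞)
    (h₀ : ∀ z : ℂ, z.re = 0 → ‖∑ i ∈ s, c i * Complex.exp (a i + b i * z)‖ₑ ≤ A)
    (h₁ : ∀ z : ℂ, z.re = 1 → ‖∑ i ∈ s, c i * Complex.exp (a i + b i * z)‖ₑ ≤ B)
    {θ : ℝ} (hθ : θ ∈ Set.Icc 0 1) :
    ‖∑ i ∈ s, c i * Complex.exp (a i + b i * θ)‖ₑ ≤ A ^ (1 - θ) * B ^ θ := by
  lift A to NNReal using hA
  lift B to NNReal using hB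
  have hd : Differentiable ℂ fun z => ∑ i ∈ s, c i * Complex.exp (a i + b i * z) := by fun_prop
  have hinterp := norm_le_interp_of_mem_verticalClosedStrip₀₁' _ (z := θ) hθ hd.diffContOnCl
    (bddAbove_norm_sum_mul_cexp s c a b) (a := A) (b := B)
    (fun z hz => by exact_mod_cast h₀ z hz) (fun z hz => by exact_mod_cast h₁ z hz)
  rw [← ENNReal.coe_rpow_of_nonneg _ (by linarith [hθ.2]), ← ENNReal.coe_rpow_of_nonneg _ hθ.1]
  exact_mod_cast hinterp

variable {α β : Type*} {mα : MeasurableSpace α} {mβ : MeasurableSpace β}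
  {μ : Measure α} {ν : Measure β}

/-- The space of integrable complex simple functions, the domain of the bilinear forms to which the
Riesz–Thorin theorem is applied. -/
def integrableSimpleFunc (μ : Measure α) : Submodule ℂ (SimpleFunc α ℂ) where
  carrier := {f | Integrable f μ}
  add_mem' hf hg := hf.add hg
  zero_mem' := integrable_zero α ℂ μ
  smul_mem' c _ hf := hf.smul c

theorem eLpNorm_integrableSimpleFunc_ne_top (f : integrableSimpleFunc μ) (p : ℝ≥0∞) :
    eLpNorm f.1 p μ ≠ ∞ :=
  (SimpleFunc.memLp_of_finite_measure_preimage p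
    (SimpleFunc.integrable_iff.1 f.2)).eLpNorm_ne_top

/-- The simple function `x ↦ k (f x) * f x`. The factor `f x` keeps it integrable whatever the
value `k 0` is. -/
def rescale (k : ℂ → ℂ) (f : integrableSimpleFunc μ) : integrableSimpleFunc μ :=
  ⟨f.1.map fun y => k y * y, SimpleFunc.integrable_iff_finMeasSupp.2
    ((SimpleFunc.integrable_iff_finMeasSupp.1 f.2).map (mul_zero _))⟩

theorem rescale_eq_sum (k : ℂ → ℂ) (f : integrableSimpleFunc μ) :
    rescale k f = ∑ y ∈ f.1.range, k y • rescale (Pi.single y 1) f := by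
  ext x
  have hsum (s : Finset ℂ) (F : ℂ → integrableSimpleFunc μ) :
      (∑ y ∈ s, F y).1 x = ∑ y ∈ s, (F y).1 x :=
    map_sum (AddMonoidHom.mk' (fun g : integrableSimpleFunc μ => g.1 x) fun _ _ => rfl) F s
  rw [hsum]
  simp [rescale, Pi.single_apply]

theorem bilin_rescale_eq_sum (Λ : integrableSimpleFunc μ →ₗ[ℂ] integrableSimpleFunc ν →ₗ[ℂ] ℂ)
    (f : integrableSimpleFunc μ) (g : integrableSimpleFunc ν) (k l : ℂ → ℂ) :
    Λ (rescale k f) (rescale l g) = ∑ y ∈ f.1.range ×ˢ g.1.range,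
      Λ (rescale (Pi.single y.1 1) f) (rescale (Pi.single y.2 1) g) * (k y.1 * l y.2) := by
  rw [rescale_eq_sum k f, rescale_eq_sum l g, Finset.sum_product]
  simp only [map_sum, LinearMap.sum_apply, map_smul, LinearMap.smul_apply, smul_eq_mul,
    Finset.mul_sum]
  rw [Finset.sum_comm]
  exact Finset.sum_congr rfl fun _ _ => Finset.sum_congr rfl fun _ _ => by ring

/-- The factor `|y| ^ (w - 1)`, written so as to be entire in `w` also for `y = 0`. Rescaling by it
turns `|f|` into `|f| ^ Re w` and gives the analytic families of the Riesz–Thorin theorem. -/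
def powFactor (w y : ℂ) : ℂ := Complex.exp ((w - 1) * Real.log ‖y‖)

theorem norm_powFactor_mul_self {w : ℂ} (hw : w.re ≠ 0) (y : ℂ) :
    ‖powFactor w y * y‖ = ‖y‖ ^ w.re := by
  rcases eq_or_ne y 0 with rfl | hy
  · simp [Real.zero_rpow hw]
  · have hy' : 0 < ‖y‖ := norm_pos_iff.2 hy
    rw [norm_mul, powFactor, Complex.norm_exp, Complex.re_mul_ofReal, Complex.sub_re,
      Complex.one_re, mul_comm (w.re - 1), ← Real.rpow_def_of_pos hy', Real.rpow_sub_one hy'.ne',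
      div_mul_cancel₀ _ hy'.ne']

theorem eLpNorm_rescale_powFactor {w : ℂ} (hw : 0 < w.re) (f : integrableSimpleFunc μ)
    (q : ℝ≥0∞) :
    eLpNorm (rescale (powFactor w) f).1 q μ = eLpNorm f.1 (q * ENNReal.ofReal w.re) μ ^ w.re := by
  rw [← eLpNorm_norm_rpow _ hw]
  refine eLpNorm_congr_norm_ae (ae_of_all _ fun x => ?_)
  rw [Real.norm_of_nonneg (by positivity)]
  exact norm_powFactor_mul_self hw.ne' _

theorem rescale_powFactor_one (f : integrableSimpleFunc μ) : rescale (powFactor 1) f = f := by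
  ext x
  simp [rescale, powFactor]

theorem enorm_bilin_le_interp_of_rescale
    (Λ : integrableSimpleFunc μ →ₗ[ℂ] integrableSimpleFunc ν →ₗ[ℂ] ℂ)
    (f : integrableSimpleFunc μ) (g : integrableSimpleFunc ν)
    {A B : ℝ≥0∞} (hA : A ≠ ∞) (hB : B ≠ ∞) {a₀ a₁ b₀ b₁ : ℝ}
    (h₀ : ∀ w v : ℂ, w.re = a₀ → v.re = b₀ →
      ‖Λ (rescale (powFactor w) f) (rescale (powFactor v) g)‖ₑ ≤ A)
    (h₁ : ∀ w v : ℂ, w.re = a₁ → v.re = b₁ →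
      ‖Λ (rescale (powFactor w) f) (rescale (powFactor v) g)‖ₑ ≤ B)
    {θ : ℝ} (hθ : θ ∈ Set.Icc 0 1) (ha : (1 - θ) * a₀ + θ * a₁ = 1)
    (hb : (1 - θ) * b₀ + θ * b₁ = 1) :
    ‖Λ f g‖ₑ ≤ A ^ (1 - θ) * B ^ θ := by
  let w (z : ℂ) : ℂ := a₀ + (a₁ - a₀ : ℝ) * z
  let v (z : ℂ) : ℂ := b₀ + (b₁ - b₀ : ℝ) * z
  have hexp (z : ℂ) : Λ (rescale (powFactor (w z)) f) (rescale (powFactor (v z)) g)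
      = ∑ y ∈ f.1.range ×ˢ g.1.range,
        Λ (rescale (Pi.single y.1 1) f) (rescale (Pi.single y.2 1) g) * Complex.exp
          (((a₀ - 1) * Real.log ‖y.1‖ + (b₀ - 1) * Real.log ‖y.2‖ : ℝ)
            + ((a₁ - a₀) * Real.log ‖y.1‖ + (b₁ - b₀) * Real.log ‖y.2‖ : ℝ) * z) := by
    rw [bilin_rescale_eq_sum]
    refine Finset.sum_congr rfl fun y _ => ?_
    rw [powFactor, powFactor, ← Complex.exp_add]
    congr 2
    push_cast [w, v]
    ring
  have hinterp := enorm_sum_mul_cexp_le_interp hA hB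
    (fun z hz => hexp z ▸ h₀ (w z) (v z) (by simp [w, hz]) (by simp [v, hz]))
    (fun z hz => hexp z ▸ h₁ (w z) (v z) (by simp [w, hz]) (by simp [v, hz])) hθ
  have hw : w θ = 1 := by
    rw [← Complex.ofReal_one, ← ha]
    push_cast [w]
    ring
  have hv : v θ = 1 := by
    rw [← Complex.ofReal_one, ← hb]
    push_cast [v]
    ring
  rwa [← hexp, hw, hv, rescale_powFactor_one, rescale_powFactor_one] at hinterp

theorem mul_rpow_interp {M₀ M₁ F G : ℝ≥0∞} {θ a₀ a₁ b₀ b₁ : ℝ} (hθ : θ ∈ Set.Icc 0 1)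
    (ha₀ : 0 ≤ a₀) (ha₁ : 0 ≤ a₁) (ha : (1 - θ) * a₀ + θ * a₁ = 1)
    (hb₀ : 0 ≤ b₀) (hb₁ : 0 ≤ b₁) (hb : (1 - θ) * b₀ + θ * b₁ = 1) :
    (M₀ * (F ^ a₀ * G ^ b₀)) ^ (1 - θ) * (M₁ * (F ^ a₁ * G ^ b₁)) ^ θ
      = M₀ ^ (1 - θ) * M₁ ^ θ * (F * G) := by
  have hθ₀ := hθ.1
  have hθ₁ : 0 ≤ 1 - θ := sub_nonneg.2 hθ.2
  have hpow {X : ℝ≥0∞} {c₀ c₁ : ℝ} (hc₀ : 0 ≤ c₀) (hc₁ : 0 ≤ c₁)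
      (hc : (1 - θ) * c₀ + θ * c₁ = 1) : (X ^ c₀) ^ (1 - θ) * (X ^ c₁) ^ θ = X := by
    rw [← ENNReal.rpow_mul, ← ENNReal.rpow_mul, ← ENNReal.rpow_add_of_nonneg _ _ (by positivity)
      (by positivity), mul_comm c₀, mul_comm c₁, hc, ENNReal.rpow_one]
  simp only [ENNReal.mul_rpow_of_nonneg _ _ hθ₀, ENNReal.mul_rpow_of_nonneg _ _ hθ₁]
  calc M₀ ^ (1 - θ) * ((F ^ a₀) ^ (1 - θ) * (G ^ b₀) ^ (1 - θ))
        * (M₁ ^ θ * ((F ^ a₁) ^ θ * (G ^ b₁) ^ θ))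
      = M₀ ^ (1 - θ) * M₁ ^ θ * (((F ^ a₀) ^ (1 - θ) * (F ^ a₁) ^ θ)
        * ((G ^ b₀) ^ (1 - θ) * (G ^ b₁) ^ θ)) := by ring
    _ = M₀ ^ (1 - θ) * M₁ ^ θ * (F * G) := by rw [hpow ha₀ ha₁ ha, hpow hb₀ hb₁ hb]

theorem enorm_bilin_rescale_powFactor_le
    {Λ : integrableSimpleFunc μ →ₗ[ℂ] integrableSimpleFunc ν →ₗ[ℂ] ℂ} {q s : ℝ}
    (hq : 0 < q) (hs : 0 < s) {M : ℝ≥0∞}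
    (h : ∀ f g, ‖Λ f g‖ₑ ≤ M * (eLpNorm f.1 (.ofReal q) μ * eLpNorm g.1 (.ofReal s) ν))
    {p r : ℝ} (hp : 0 < p) (hr : 0 < r) (f : integrableSimpleFunc μ) (g : integrableSimpleFunc ν)
    (w v : ℂ) (hw : w.re = p / q) (hv : v.re = r / s) :
    ‖Λ (rescale (powFactor w) f) (rescale (powFactor v) g)‖ₑ
      ≤ M * (eLpNorm f.1 (.ofReal p) μ ^ (p / q) * eLpNorm g.1 (.ofReal r) ν ^ (r / s)) := by
  refine (h (rescale (powFactor w) f) (rescale (powFactor v) g)).trans_eq ?_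
  rw [eLpNorm_rescale_powFactor (hw ▸ by positivity),
    eLpNorm_rescale_powFactor (hv ▸ by positivity), hw, hv,
    ← ENNReal.ofReal_mul hq.le, ← ENNReal.ofReal_mul hs.le, mul_div_cancel₀ _ hq.ne',
    mul_div_cancel₀ _ hs.ne']

theorem riesz_thorin_integrableSimpleFunc
    (Λ : integrableSimpleFunc μ →ₗ[ℂ] integrableSimpleFunc ν →ₗ[ℂ] ℂ)
    {p p₀ p₁ r r₀ r₁ : ℝ} (hp : 0 < p) (hp₀ : 0 < p₀) (hp₁ : 0 < p₁)
    (hr : 0 < r) (hr₀ : 0 < r₀) (hr₁ : 0 < r₁) {M₀ M₁ : ℝ≥0∞} (hM₀ : M₀ ≠ ∞) (hM₁ : M₁ ≠ ∞)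
    (h₀ : ∀ f g, ‖Λ f g‖ₑ ≤ M₀ * (eLpNorm f.1 (.ofReal p₀) μ * eLpNorm g.1 (.ofReal r₀) ν))
    (h₁ : ∀ f g, ‖Λ f g‖ₑ ≤ M₁ * (eLpNorm f.1 (.ofReal p₁) μ * eLpNorm g.1 (.ofReal r₁) ν))
    {θ : ℝ} (hθ : θ ∈ Set.Icc 0 1) (hpθ : 1 / p = (1 - θ) / p₀ + θ / p₁)
    (hrθ : 1 / r = (1 - θ) / r₀ + θ / r₁)
    (f : integrableSimpleFunc μ) (g : integrableSimpleFunc ν) :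
    ‖Λ f g‖ₑ ≤
      M₀ ^ (1 - θ) * M₁ ^ θ * (eLpNorm f.1 (.ofReal p) μ * eLpNorm g.1 (.ofReal r) ν) := by
  have hfin {M : ℝ≥0∞} (hM : M ≠ ∞) {a b : ℝ} (ha : 0 ≤ a) (hb : 0 ≤ b) :
      M * (eLpNorm f.1 (.ofReal p) μ ^ a * eLpNorm g.1 (.ofReal r) ν ^ b) ≠ ∞ :=
    ENNReal.mul_ne_top hM (ENNReal.mul_ne_top
      (ENNReal.rpow_ne_top_of_nonneg ha (eLpNorm_integrableSimpleFunc_ne_top f _))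
      (ENNReal.rpow_ne_top_of_nonneg hb (eLpNorm_integrableSimpleFunc_ne_top g _)))
  have ha : (1 - θ) * (p / p₀) + θ * (p / p₁) = 1 := by
    linear_combination (-p) * hpθ + mul_one_div_cancel hp.ne'
  have hb : (1 - θ) * (r / r₀) + θ * (r / r₁) = 1 := by
    linear_combination (-r) * hrθ + mul_one_div_cancel hr.ne'
  rw [← mul_rpow_interp (a₀ := p / p₀) (a₁ := p / p₁) (b₀ := r / r₀) (b₁ := r / r₁) hθ
    (by positivity) (by positivity) ha (by positivity) (by positivity) hb]
  exact enorm_bilin_le_interp_of_rescale Λ f g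
    (hfin hM₀ (by positivity) (by positivity)) (hfin hM₁ (by positivity) (by positivity))
    (enorm_bilin_rescale_powFactor_le hp₀ hr₀ h₀ hp hr f g)
    (enorm_bilin_rescale_powFactor_le hp₁ hr₁ h₁ hp hr f g) hθ ha hb

end RieszThorin

/-! ### Duality between `L^p` and `L^q` -/

section Duality

variable {α : Type*} {mα : MeasurableSpace α} {μ : Measure α}

theorem enorm_integral_mul_le_eLpNorm_mul_eLpNorm {p q : ℝ≥0∞} [p.HolderConjugate q]
    {f g : α → ℂ} (hf : AEStronglyMeasurable f μ) (hg : AEStronglyMeasurable g μ) :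
    ‖∫ x, f x * g x ∂μ‖ₑ ≤ eLpNorm f p μ * eLpNorm g q μ :=
  calc ‖∫ x, f x * g x ∂μ‖ₑ ≤ ∫⁻ x, ‖f x * g x‖ₑ ∂μ := enorm_integral_le_lintegral_enorm _
    _ = eLpNorm (f • g) 1 μ := eLpNorm_one_eq_lintegral_enorm.symm
    _ ≤ eLpNorm f p μ * eLpNorm g q μ := eLpNorm_smul_le_mul_eLpNorm hg hf

theorem exists_integrableSimpleFunc_tendsto {f : α → ℂ} (hf : Integrable f μ) {p : ℝ≥0∞}
    (hp : p ≠ ∞) (hfp : MemLp f p μ) :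
    ∃ F : ℕ → integrableSimpleFunc μ,
      Filter.Tendsto (fun k => eLpNorm (⇑(F k).1 - f) 1 μ) Filter.atTop (nhds 0) ∧
      Filter.Tendsto (fun k => eLpNorm (⇑(F k).1 - f) p μ) Filter.atTop (nhds 0) := by
  obtain ⟨f', hf'm, hff'⟩ := hf.aestronglyMeasurable
  have hcongr (r : ℝ≥0∞) (g : α → ℂ) : eLpNorm (g - f) r μ = eLpNorm (g - f') r μ :=
    eLpNorm_congr_ae ((ae_eq_refl g).sub hff')
  have hf' := hf.congr hff'
  simp only [hcongr]
  exact ⟨fun k => ⟨SimpleFunc.approxOn f' hf'm.measurable (Set.range f' ∪ {0}) 0 (by simp) k,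
      SimpleFunc.integrable_approxOn_range hf'm.measurable hf' k⟩,
    SimpleFunc.tendsto_approxOn_range_Lp_eLpNorm ENNReal.one_ne_top hf'm.measurable
      (memLp_one_iff_integrable.2 hf').eLpNorm_lt_top,
    SimpleFunc.tendsto_approxOn_range_Lp_eLpNorm hp hf'm.measurable
      ((memLp_congr_ae hff').1 hfp).eLpNorm_lt_top⟩

theorem enorm_integral_mul_le_of_forall_simpleFunc {h : α → ℂ} (hh : MemLp h ∞ μ) {p C : ℝ≥0∞}
    (hp₁ : 1 ≤ p) (hp : p ≠ ∞) (hC : C ≠ ∞)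
    (hle : ∀ g : integrableSimpleFunc μ, ‖∫ x, h x * g.1 x ∂μ‖ₑ ≤ C * eLpNorm g.1 p μ)
    {g : α → ℂ} (hg : Integrable g μ) (hgp : MemLp g p μ) :
    ‖∫ x, h x * g x ∂μ‖ₑ ≤ C * eLpNorm g p μ := by
  obtain ⟨G, hG₁, hGp⟩ := exists_integrableSimpleFunc_tendsto hg hp hgp
  have hint {k : α → ℂ} (hk : Integrable k μ) : Integrable (fun x => h x * k x) μ :=
    memLp_one_iff_integrable.1 ((memLp_one_iff_integrable.2 hk).mul hh)
  have hbound (k : ℕ) : ‖∫ x, h x * g x ∂μ‖ₑ ≤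
      C * (eLpNorm (⇑(G k).1 - g) p μ + eLpNorm g p μ)
        + eLpNorm h ∞ μ * eLpNorm (⇑(G k).1 - g) 1 μ := by
    have hsplit : ∫ x, h x * g x ∂μ
        = ∫ x, h x * (G k).1 x ∂μ - ∫ x, h x * (⇑(G k).1 - g) x ∂μ := by
      rw [← integral_sub (hint (G k).2) (hint ((G k).2.sub hg))]
      simp [mul_sub]
    have hnorm : eLpNorm (G k).1 p μ ≤ eLpNorm (⇑(G k).1 - g) p μ + eLpNorm g p μ := by
      simpa using eLpNorm_add_le ((G k).2.sub hg).aestronglyMeasurable hg.aestronglyMeasurable hp₁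
    rw [hsplit]
    exact enorm_sub_le.trans (add_le_add ((hle (G k)).trans (mul_le_mul_right hnorm C))
      (enorm_integral_mul_le_eLpNorm_mul_eLpNorm hh.1 ((G k).2.sub hg).aestronglyMeasurable))
  have hlim := (ENNReal.Tendsto.const_mul (a := C) (hGp.add_const (eLpNorm g p μ))
    (.inr hC)).add (ENNReal.Tendsto.const_mul (a := eLpNorm h ∞ μ) hG₁ (.inr hh.2.ne))
  simpa using ge_of_tendsto' hlim hbound

/-- The function `k` with `h * k = |h| ^ q` and `|k| = |h| ^ (q - 1)`, for which Hölder's inequality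
`|∫ h k| ≤ ‖h‖_q ‖k‖_p` with conjugate exponents is an equality. -/
def holderExtremizer (q : ℝ) (h : α → ℂ) (x : α) : ℂ :=
  starRingEnd ℂ (h x) * (‖h x‖ ^ (q - 2) : ℝ)

theorem mul_holderExtremizer {q : ℝ} (hq : q ≠ 0) (h : α → ℂ) (x : α) :
    h x * holderExtremizer q h x = (‖h x‖ ^ q : ℝ) := by
  rw [holderExtremizer, ← mul_assoc, Complex.mul_conj, Complex.normSq_eq_norm_sq,
    ← Complex.ofReal_mul, ← Real.rpow_two, ← Real.rpow_add' (norm_nonneg _) (by simpa using hq),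
    add_sub_cancel]

theorem norm_holderExtremizer {q : ℝ} (hq : q ≠ 1) (h : α → ℂ) (x : α) :
    ‖holderExtremizer q h x‖ = ‖h x‖ ^ (q - 1) := by
  have hq' : 1 + (q - 2) = q - 1 := by ring
  rw [holderExtremizer, norm_mul, RCLike.norm_conj, Complex.norm_real,
    Real.norm_of_nonneg (by positivity), ← Real.rpow_one_add' (norm_nonneg _)
      (by rwa [hq', sub_ne_zero]), hq']

theorem aestronglyMeasurable_holderExtremizer (q : ℝ) {h : α → ℂ}
    (hh : AEStronglyMeasurable h μ) : AEStronglyMeasurable (holderExtremizer q h) μ :=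
  (Complex.continuous_conj.comp_aestronglyMeasurable hh).mul
    (Complex.continuous_ofReal.comp_aestronglyMeasurable
      (hh.norm.aemeasurable.pow_const _).aestronglyMeasurable)

theorem eLpNorm_holderExtremizer {p : ℝ≥0∞} {q : ℝ} (hq : 1 < q) (h : α → ℂ) :
    eLpNorm (holderExtremizer q h) p μ = eLpNorm h (p * .ofReal (q - 1)) μ ^ (q - 1) := by
  rw [← eLpNorm_norm_rpow h (sub_pos.2 hq)]
  refine eLpNorm_congr_norm_ae (ae_of_all _ fun x => ?_)
  rw [norm_holderExtremizer hq.ne', Real.norm_of_nonneg (by positivity)]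

theorem enorm_integral_mul_holderExtremizer {q : ℝ} (hq : 0 < q) {h : α → ℂ}
    (hh : MemLp h (.ofReal q) μ) :
    ‖∫ x, h x * holderExtremizer q h x ∂μ‖ₑ = eLpNorm h (.ofReal q) μ ^ q := by
  simp only [mul_holderExtremizer hq.ne']
  rw [integral_complex_ofReal, ← ofReal_norm, Complex.norm_real,
    Real.norm_of_nonneg (integral_nonneg fun x => by positivity),
    hh.eLpNorm_eq_integral_rpow_norm (by simpa using hq) ENNReal.ofReal_ne_top,
    ENNReal.toReal_ofReal hq.le, ENNReal.ofReal_rpow_of_nonneg (by positivity) hq.le,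
    ← Real.rpow_mul (by positivity), inv_mul_cancel₀ hq.ne', Real.rpow_one]

theorem eLpNorm_le_of_forall_enorm_integral_mul_le {p q : ℝ} (hpq : p.HolderConjugate q)
    {h : α → ℂ} (hh : MemLp h (.ofReal q) μ) (hh' : MemLp h (.ofReal (q - 1)) μ) {C : ℝ≥0∞}
    (hle : ∀ g, Integrable g μ → MemLp g (.ofReal p) μ →
      ‖∫ x, h x * g x ∂μ‖ₑ ≤ C * eLpNorm g (.ofReal p) μ) :
    eLpNorm h (.ofReal q) μ ≤ C := by
  have hq : 1 < q := hpq.symm.lt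
  have hkm := aestronglyMeasurable_holderExtremizer q hh.1
  have hk : eLpNorm (holderExtremizer q h) (.ofReal p) μ = eLpNorm h (.ofReal q) μ ^ (q - 1) := by
    rw [eLpNorm_holderExtremizer hq, ← ENNReal.ofReal_mul hpq.nonneg, mul_comm p,
      hpq.symm.sub_one_mul_conj]
  have hk₁ : eLpNorm (holderExtremizer q h) 1 μ = eLpNorm h (.ofReal (q - 1)) μ ^ (q - 1) := by
    rw [eLpNorm_holderExtremizer hq, one_mul]
  have htop {x : ℝ≥0∞} (hx : x ≠ ∞) : x ^ (q - 1) ≠ ∞ :=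
    ENNReal.rpow_ne_top_of_nonneg (sub_pos.2 hq).le hx
  have hkey := hle (holderExtremizer q h)
    (memLp_one_iff_integrable.1 ⟨hkm, hk₁ ▸ (htop hh'.2.ne).lt_top⟩)
    ⟨hkm, hk ▸ (htop hh.2.ne).lt_top⟩
  rw [enorm_integral_mul_holderExtremizer (by linarith) hh, hk] at hkey
  rcases eq_or_ne (eLpNorm h (.ofReal q) μ) 0 with h0 | h0
  · simp [h0]
  · refine (ENNReal.mul_le_mul_iff_left
      (ENNReal.rpow_pos (pos_iff_ne_zero.2 h0) hh.2.ne).ne' (htop hh.2.ne)).1 (hkey.trans_eq' ?_)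
    rw [ENNReal.rpow_sub _ _ h0 hh.2.ne, ENNReal.rpow_one, ENNReal.mul_div_cancel h0 hh.2.ne]

end Duality

/-! ### The Hausdorff–Young inequality -/

section HausdorffYoung

variable {V : Type*} [NormedAddCommGroup V] [InnerProductSpace ℝ V] [FiniteDimensional ℝ V]
  [MeasurableSpace V] [BorelSpace V]

theorem ae_eq_of_forall_integral_schwartzMap_mul_eq {f g : V → ℂ}
    (hf : LocallyIntegrable f) (hg : LocallyIntegrable g)
    (h : ∀ φ : 𝓢(V, ℂ), ∫ x, φ x * f x = ∫ x, φ x * g x) : f =ᵐ[volume] g :=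
  ae_eq_of_integral_contDiff_smul_eq hf hg fun φ hφ hφc => by
    simpa only [Complex.real_smul] using! h ((hφc.comp_left (g := Complex.ofReal) rfl).toSchwartzMap
      (Complex.ofRealCLM.contDiff.comp hφ))

theorem enorm_fourier_le (f : V → ℂ) (ξ : V) : ‖𝓕 f ξ‖ₑ ≤ eLpNorm f 1 volume :=
  (enorm_integral_le_lintegral_enorm _).trans_eq <| by
    simp [eLpNorm_one_eq_lintegral_enorm, ← ofReal_norm, Circle.norm_smul]

theorem continuous_fourier {f : V → ℂ} (hf : Integrable f) : Continuous (𝓕 f) :=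
  VectorFourier.fourierIntegral_continuous Real.continuous_fourierChar continuous_inner hf

theorem eLpNorm_top_fourier_le (f : V → ℂ) : eLpNorm (𝓕 f) ∞ volume ≤ eLpNorm f 1 volume :=
  eLpNormEssSup_le_of_ae_enorm_bound (ae_of_all _ (enorm_fourier_le f))

theorem memLp_top_fourier {f : V → ℂ} (hf : Integrable f) : MemLp (𝓕 f) ∞ volume :=
  ⟨(continuous_fourier hf).aestronglyMeasurable,
    (eLpNorm_top_fourier_le f).trans_lt (memLp_one_iff_integrable.2 hf).2⟩

theorem integrable_fourier_mul {f g : V → ℂ} (hf : Integrable f) (hg : Integrable g) :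
    Integrable fun ξ => 𝓕 f ξ * g ξ :=
  memLp_one_iff_integrable.1 ((memLp_one_iff_integrable.2 hg).mul (memLp_top_fourier hf))

theorem integral_fourier_smul_mul_eq {f g : V → ℂ} (hf : Integrable f) (hg : Integrable g) (c : ℝ) :
    ∫ ξ, 𝓕 f (c • ξ) * g ξ = ∫ x, 𝓕 g (c • x) * f x := by
  have hc (f : V → ℂ) (ξ : V) :
      𝓕 f (c • ξ) = VectorFourier.fourierIntegral Real.fourierChar volume (c • innerₗ V) f ξ := by
    simp [Real.fourier_eq, VectorFourier.fourierIntegral, inner_smul_right]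
  have hflip : (c • innerₗ V).flip = c • innerₗ V := by
    ext
    simp [real_inner_comm]
  have hcont : Continuous fun z : V × V => (c • innerₗ V) z.1 z.2 :=
    continuous_const.mul continuous_inner
  simpa only [hc, hflip, smul_eq_mul, mul_comm] using
    VectorFourier.integral_fourierIntegral_smul_eq_flip Real.continuous_fourierChar hcont hf hg

theorem integral_fourier_mul_eq {f g : V → ℂ} (hf : Integrable f) (hg : Integrable g) :
    ∫ ξ, 𝓕 f ξ * g ξ = ∫ x, 𝓕 g x * f x := by
  simpa only [one_smul] using integral_fourier_smul_mul_eq hf hg 1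

theorem fourier_toLp_two_ae_eq {f : V → ℂ} (hf : Integrable f) (hf₂ : MemLp f 2 volume) :
    (𝓕 (hf₂.toLp f) : Lp ℂ 2 (volume : Measure V)) =ᵐ[volume] 𝓕 f := by
  refine ae_eq_of_forall_integral_schwartzMap_mul_eq
    ((Lp.memLp _).locallyIntegrable one_le_two)
    (continuous_fourier hf).locallyIntegrable fun φ => ?_
  calc ∫ x, φ x * (𝓕 (hf₂.toLp f) : Lp ℂ 2 (volume : Measure V)) x
      = Lp.toTemperedDistribution (𝓕 (hf₂.toLp f)) φ := by
        rw [Lp.toTemperedDistribution_apply]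
        rfl
    _ = Lp.toTemperedDistribution (hf₂.toLp f) (𝓕 φ) := by
        rw [← Lp.fourier_toTemperedDistribution_eq, TemperedDistribution.fourier_apply]
    _ = ∫ x, 𝓕 (φ : V → ℂ) x * f x := by
        rw [Lp.toTemperedDistribution_apply]
        exact integral_congr_ae (hf₂.coeFn_toLp.mono fun x hx => congrArg (𝓕 (φ : V → ℂ) x * ·) hx)
    _ = ∫ x, φ x * 𝓕 f x := by
        rw [integral_fourier_mul_eq φ.integrable hf]
        simp only [mul_comm]

theorem eLpNorm_two_fourier {f : V → ℂ} (hf : Integrable f) (hf₂ : MemLp f 2 volume) :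
    eLpNorm (𝓕 f) 2 volume = eLpNorm f 2 volume := by
  rw [← eLpNorm_congr_ae (fourier_toLp_two_ae_eq hf hf₂), ← Lp.enorm_def, ← ofReal_norm,
    Lp.norm_fourier_eq, ofReal_norm, Lp.enorm_def, eLpNorm_congr_ae hf₂.coeFn_toLp]

theorem fourier_add_of_integrable {f g : V → ℂ} (hf : Integrable f) (hg : Integrable g) :
    𝓕 (f + g) = 𝓕 f + 𝓕 g :=
  VectorFourier.fourierIntegral_add Real.continuous_fourierChar continuous_inner hf hg

theorem fourier_const_smul (c : ℂ) (f : V → ℂ) : 𝓕 (c • f) = c • 𝓕 f :=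
  VectorFourier.fourierIntegral_const_smul _ _ _ _ _

/-- The bilinear form `(f, g) ↦ ∫ 𝓕 f * g`, through which the Riesz–Thorin theorem is applied to the
Fourier transform. -/
def fourierForm (V : Type*) [NormedAddCommGroup V] [InnerProductSpace ℝ V]
    [FiniteDimensional ℝ V] [MeasurableSpace V] [BorelSpace V] :
    integrableSimpleFunc (volume : Measure V) →ₗ[ℂ]
      integrableSimpleFunc (volume : Measure V) →ₗ[ℂ] ℂ :=
  LinearMap.mk₂ ℂ (fun f g => ∫ ξ, 𝓕 (f.1 : V → ℂ) ξ * g.1 ξ)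
    (fun f₁ f₂ g => by
      rw [← integral_add (integrable_fourier_mul f₁.2 g.2) (integrable_fourier_mul f₂.2 g.2)]
      simp [← add_mul, fourier_add_of_integrable f₁.2 f₂.2])
    (fun c f g => by
      rw [← integral_smul]
      simp [fourier_const_smul, mul_assoc])
    (fun f g₁ g₂ => by
      rw [← integral_add (integrable_fourier_mul f.2 g₁.2) (integrable_fourier_mul f.2 g₂.2)]
      simp [mul_add])
    (fun c f g => by
      rw [← integral_smul]
      simp [mul_left_comm])

theorem enorm_fourierForm_le {p : ℝ} (hp : p ∈ Set.Icc 1 2)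
    (f g : integrableSimpleFunc (volume : Measure V)) :
    ‖fourierForm V f g‖ₑ ≤ eLpNorm f.1 (.ofReal p) volume * eLpNorm g.1 (.ofReal p) volume := by
  have hp₀ : 0 < p := by linarith [hp.1]
  have hmeas (f : integrableSimpleFunc (volume : Measure V)) :=
    (continuous_fourier f.2).aestronglyMeasurable (μ := volume)
  have h₀ (f g : integrableSimpleFunc (volume : Measure V)) : ‖fourierForm V f g‖ₑ ≤
      1 * (eLpNorm f.1 (.ofReal 1) volume * eLpNorm g.1 (.ofReal 1) volume) := by
    rw [one_mul, ENNReal.ofReal_one]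
    exact (enorm_integral_mul_le_eLpNorm_mul_eLpNorm (p := ∞) (q := 1) (hmeas f) g.2.1).trans
      (mul_le_mul_left (eLpNorm_top_fourier_le f.1) _)
  have h₁ (f g : integrableSimpleFunc (volume : Measure V)) : ‖fourierForm V f g‖ₑ ≤
      1 * (eLpNorm f.1 (.ofReal 2) volume * eLpNorm g.1 (.ofReal 2) volume) := by
    have hf₂ : MemLp f.1 2 volume := ⟨f.2.1, (eLpNorm_integrableSimpleFunc_ne_top f 2).lt_top⟩
    rw [one_mul, ENNReal.ofReal_ofNat, ← eLpNorm_two_fourier f.2 hf₂]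
    exact enorm_integral_mul_le_eLpNorm_mul_eLpNorm (p := 2) (q := 2) (hmeas f) g.2.1
  have hθ : 1 / p = (1 - (2 - 2 / p)) / 1 + (2 - 2 / p) / 2 := by ring
  have hinterp := riesz_thorin_integrableSimpleFunc (fourierForm V) hp₀ one_pos two_pos hp₀ one_pos
    two_pos ENNReal.one_ne_top ENNReal.one_ne_top h₀ h₁ (θ := 2 - 2 / p)
    ⟨by rw [sub_nonneg, div_le_iff₀ hp₀]; linarith [hp.1],
      by rw [sub_le_comm, le_div_iff₀ hp₀]; linarith [hp.2]⟩ hθ hθ f g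
  simpa using hinterp

theorem enorm_integral_fourier_mul_le {p : ℝ} (hp : p ∈ Set.Icc 1 2) {f g : V → ℂ}
    (hf : Integrable f) (hfp : MemLp f (.ofReal p) volume) (hg : Integrable g)
    (hgp : MemLp g (.ofReal p) volume) :
    ‖∫ ξ, 𝓕 f ξ * g ξ‖ₑ ≤ eLpNorm f (.ofReal p) volume * eLpNorm g (.ofReal p) volume := by
  have hp₁ : 1 ≤ ENNReal.ofReal p := ENNReal.one_le_ofReal.2 hp.1
  rw [integral_fourier_mul_eq hf hg, mul_comm (eLpNorm f _ _)]
  refine enorm_integral_mul_le_of_forall_simpleFunc (memLp_top_fourier hg) hp₁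
    ENNReal.ofReal_ne_top hgp.2.ne (fun F => ?_) hf hfp
  rw [integral_fourier_mul_eq hg F.2, mul_comm]
  exact enorm_integral_mul_le_of_forall_simpleFunc (memLp_top_fourier F.2) hp₁
    ENNReal.ofReal_ne_top (eLpNorm_integrableSimpleFunc_ne_top F (.ofReal p))
    (enorm_fourierForm_le hp F) hg hgp

theorem eLpNorm_fourier_schwartzMap_le {p q : ℝ≥0∞} [hpq : p.HolderConjugate q] (hp : p ≤ 2)
    (φ : 𝓢(V, ℂ)) : eLpNorm (𝓕 (φ : V → ℂ)) q volume ≤ eLpNorm φ p volume := by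
  rcases (ENNReal.HolderConjugate.one_le p q).eq_or_lt with rfl | hp₁
  · obtain rfl : q = ∞ := by simpa using hpq.conj_eq
    exact eLpNorm_top_fourier_le φ
  · have hp' : p ≠ ∞ := (hp.trans_lt ENNReal.ofNat_lt_top).ne
    have hq' : q ≠ ∞ := by simpa [hpq.conj_eq, tsub_eq_zero_iff_le] using hp₁
    have hr : p.toReal ∈ Set.Ioc 1 2 :=
      ⟨by simpa using ENNReal.toReal_strict_mono hp' hp₁,
        by simpa using ENNReal.toReal_mono ENNReal.ofNat_ne_top hp⟩
    have hmem (r : ℝ≥0∞) : MemLp (𝓕 (φ : V → ℂ)) r volume := (𝓕 φ).memLp r volume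
    have hdual := eLpNorm_le_of_forall_enorm_integral_mul_le
      (ENNReal.HolderConjugate.toReal (q := q) hr.1) (hmem _) (hmem _)
      fun g hg hgp => enorm_integral_fourier_mul_le ⟨hr.1.le, hr.2⟩ φ.integrable (φ.memLp _) hg hgp
    rwa [ENNReal.ofReal_toReal hp', ENNReal.ofReal_toReal hq'] at hdual

/-! ### Dilations -/

theorem eLpNorm_comp_smul {c : ℝ} (hc : c ≠ 0) (f : V → ℂ) (p : ℝ≥0∞) :
    eLpNorm (fun x => f (c • x)) p volume =
      ENNReal.ofReal |(c ^ Module.finrank ℝ V)⁻¹| ^ (1 / p).toReal * eLpNorm f p volume := by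
  have hmap := (Homeomorph.smulOfNeZero c hc).measurableEmbedding.eLpNorm_map_measure
    (μ := (volume : Measure V)) (g := f) (p := p)
  rw [← smul_eq_mul, ← eLpNorm_smul_measure_of_ne_zero (by positivity),
    ← Measure.map_addHaar_smul _ hc]
  exact hmap.symm

theorem fourierInv_comp_smul {c : ℝ} (hc : c ≠ 0) (f : V → ℂ) (x : V) :
    𝓕⁻ (fun ξ => f (c • ξ)) x = |(c ^ Module.finrank ℝ V)⁻¹| * 𝓕⁻ f (c⁻¹ • x) := by
  rw [Real.fourierInv_eq, Real.fourierInv_eq, ← Complex.real_smul, ← Measure.integral_comp_smul]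
  simp [inner_smul_left, inner_smul_right, hc]

theorem fourierInv_const_smul (a : ℂ) (f : V → ℂ) : 𝓕⁻ (a • f) = a • 𝓕⁻ f :=
  VectorFourier.fourierIntegral_const_smul _ _ _ _ _

end HausdorffYoung

variable {n : ℕ}

/-! ### Functions representing tempered distributions -/

theorem IsRepresentedBy.ae_eq {u : 𝓢'(Rn n, ℂ)} {v w : Rn n → ℂ}
    (hv : IsRepresentedBy u v) (hw : IsRepresentedBy u w) : v =ᵐ[volume] w :=
  ae_eq_of_forall_integral_schwartzMap_mul_eq hv.1 hw.1 fun φ =>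
    (hv.2 φ).2.symm.trans (hw.2 φ).2

theorem IsRepresentedBy.lpNorm_eq {u : 𝓢'(Rn n, ℂ)} {v : Rn n → ℂ}
    (hv : IsRepresentedBy u v) (q : ℝ≥0∞) : lpNorm q u = eLpNorm v q volume :=
  le_antisymm (iInf₂_le v hv) (le_iInf₂ fun _ hw => (eLpNorm_congr_ae (hv.ae_eq hw)).le)

theorem isLp_iff_lpNorm_ne_top {u : 𝓢'(Rn n, ℂ)} {q : ℝ≥0∞} : IsLp q u ↔ lpNorm q u ≠ ∞ := by
  simp only [IsLp, lpNorm, ← lt_top_iff_ne_top, iInf_lt_iff, exists_prop]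
  exact exists_congr fun v => and_congr_right fun hv =>
    ⟨fun h => h.2, fun h => ⟨hv.1.aestronglyMeasurable, h⟩⟩

theorem IsRepresentedBy.ae_eq_zero_of_isVanishingOn {u : 𝓢'(Rn n, ℂ)} {v : Rn n → ℂ}
    (h : IsRepresentedBy u v) {U : Set (Rn n)} (hU : IsOpen U) (hu : IsVanishingOn u U) :
    ∀ᵐ x : Rn n, x ∈ U → v x = 0 := by
  refine hU.ae_eq_zero_of_integral_contDiff_smul_eq_zero (h.1.locallyIntegrableOn U) ?_
  intro g hg hgc hgU
  have hgc' : HasCompactSupport (fun x => (g x : ℂ)) := hgc.comp_left (g := Complex.ofReal) rfl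
  have hg' : ContDiff ℝ (⊤ : ℕ∞) (fun x => (g x : ℂ)) := Complex.ofRealCLM.contDiff.comp hg
  have hu₀ : u (hgc'.toSchwartzMap hg') = 0 :=
    hu _ <| (closure_mono fun x hx => by simpa using hx).trans hgU
  simpa using (h.2 (hgc'.toSchwartzMap hg')).2.symm.trans hu₀

theorem IsRepresentedBy.ae_eq_zero_of_notMem_dsupport {u : 𝓢'(Rn n, ℂ)} {v : Rn n → ℂ}
    (h : IsRepresentedBy u v) : ∀ᵐ x : Rn n, x ∉ dsupport u → v x = 0 := by
  suffices volume {x | x ∉ dsupport u ∧ v x ≠ 0} = 0 by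
    simpa only [ae_iff, Classical.not_imp] using this
  refine measure_null_of_locally_null _ fun x hx => ?_
  obtain ⟨U, hU, hUo, hxU⟩ := (notMem_dsupport_iff x).1 hx.1
  refine ⟨U ∩ {x | x ∉ dsupport u ∧ v x ≠ 0}, Filter.inter_mem
    (mem_nhdsWithin_of_mem_nhds (hUo.mem_nhds hxU)) self_mem_nhdsWithin,
    measure_mono_null ?_ (h.ae_eq_zero_of_isVanishingOn hUo hU)⟩
  exact fun y hy hc => hy.2.2 (hc hy.1)

theorem isClosed_dsupport (u : 𝓢'(Rn n, ℂ)) : IsClosed (dsupport u) :=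
  isClosed_sInter fun _ hs => hs.2

theorem isRepresentedBy_toTemperedDistribution {p : ℝ≥0∞} [hp : Fact (1 ≤ p)]
    (v : Lp ℂ p (volume : Measure (Rn n))) :
    IsRepresentedBy (Lp.toTemperedDistribution v) v := by
  have : p.conjExponent.HolderConjugate p := (ENNReal.HolderConjugate.conjExponent hp.out).symm
  exact ⟨(Lp.memLp v).locallyIntegrable hp.out, fun φ =>
    ⟨(φ.memLp p.conjExponent).integrable_mul (Lp.memLp v), Lp.toTemperedDistribution_apply v φ⟩⟩

theorem lpNorm_toTemperedDistribution {p : ℝ≥0∞} [Fact (1 ≤ p)]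
    (v : Lp ℂ p (volume : Measure (Rn n))) : lpNorm p (Lp.toTemperedDistribution v) = ‖v‖ₑ :=
  (isRepresentedBy_toTemperedDistribution v).lpNorm_eq p |>.trans (Lp.enorm_def v).symm

theorem isLp_toTemperedDistribution {p : ℝ≥0∞} [Fact (1 ≤ p)]
    (v : Lp ℂ p (volume : Measure (Rn n))) : IsLp p (Lp.toTemperedDistribution v) :=
  ⟨v, isRepresentedBy_toTemperedDistribution v, Lp.memLp v⟩

theorem IsLp.exists_eq_toTemperedDistribution {p : ℝ≥0∞} [Fact (1 ≤ p)] {u : 𝓢'(Rn n, ℂ)}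
    (hu : IsLp p u) :
    ∃ v : Lp ℂ p (volume : Measure (Rn n)), u = Lp.toTemperedDistribution v := by
  obtain ⟨v, hv, hvp⟩ := hu
  refine ⟨hvp.toLp v, ?_⟩
  ext φ
  rw [(hv.2 φ).2, Lp.toTemperedDistribution_apply]
  exact integral_congr_ae (hvp.coeFn_toLp.mono fun x hx => congrArg (φ x * ·) hx.symm)

/-! ### The unitary Fourier transform -/

theorem coe_schwartzFourier (φ : 𝓢(Rn n, ℂ)) :
    ⇑(schwartzFourier n φ) =
      normFactor n • fun ξ => 𝓕 (φ : Rn n → ℂ) ((2 * Real.pi)⁻¹ • ξ) :=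
  rfl

theorem coe_schwartzFourierInv (φ : 𝓢(Rn n, ℂ)) :
    ⇑(schwartzFourierInv n φ) =
      normFactor n • fun x => 𝓕⁻ (φ : Rn n → ℂ) ((2 * Real.pi)⁻¹ • x) := by
  rw [← SchwartzMap.fourierInv_coe]
  rfl

theorem normFactor_mul_self_mul_pow :
    normFactor n * normFactor n * ((2 * Real.pi) ^ n : ℝ) = 1 := by
  rw [normFactor, ← Complex.ofReal_mul, ← Complex.ofReal_mul, ← Real.rpow_natCast,
    ← Real.rpow_add (by positivity), ← Real.rpow_add (by positivity),
    show -(n : ℝ) / 2 + -n / 2 + n = 0 by ring, Real.rpow_zero, Complex.ofReal_one]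

theorem schwartzFourierInv_schwartzFourier (φ : 𝓢(Rn n, ℂ)) :
    schwartzFourierInv n (schwartzFourier n φ) = φ := by
  ext x
  have hinv : 𝓕⁻ (𝓕 (φ : Rn n → ℂ)) = φ := by
    rw [← SchwartzMap.fourier_coe, ← SchwartzMap.fourierInv_coe, fourierInv_fourier_eq]
  have hscale : |(((2 * Real.pi)⁻¹) ^ n)⁻¹| = (2 * Real.pi) ^ n := by
    rw [inv_pow, inv_inv, abs_of_pos (by positivity)]
  rw [coe_schwartzFourierInv, coe_schwartzFourier, fourierInv_const_smul]
  simp only [Pi.smul_apply, smul_eq_mul]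
  rw [fourierInv_comp_smul (by positivity), hinv, smul_smul, inv_inv,
    mul_inv_cancel₀ (by positivity), one_smul, finrank_euclideanSpace, Fintype.card_fin, hscale,
    ← mul_assoc, ← mul_assoc, normFactor_mul_self_mul_pow, one_mul]

theorem fourier_apply (u : 𝓢'(Rn n, ℂ)) (φ : 𝓢(Rn n, ℂ)) :
    fourier n u φ = u (schwartzFourier n φ) :=
  rfl

theorem fourier_fourierInv (u : 𝓢'(Rn n, ℂ)) : fourier n (fourierInv n u) = u := by
  ext φ
  exact congrArg u (schwartzFourierInv_schwartzFourier φ)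

theorem enorm_normFactor_mul_rpow_le_one {a : ℝ} (ha : a ≤ 1 / 2) :
    ‖normFactor n‖ₑ * ENNReal.ofReal ((2 * Real.pi) ^ n) ^ a ≤ 1 := by
  have h2π : 1 ≤ 2 * Real.pi := by linarith [Real.pi_gt_three]
  rw [normFactor, ← ofReal_norm, Complex.norm_real, Real.norm_of_nonneg (by positivity),
    ENNReal.ofReal_rpow_of_pos (by positivity), ← ENNReal.ofReal_mul (by positivity),
    ← Real.rpow_natCast, ← Real.rpow_mul (by positivity), ← Real.rpow_add (by positivity)]
  refine ENNReal.ofReal_le_one.2 (Real.rpow_le_one_of_one_le_of_nonpos h2π ?_)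
  nlinarith [n.cast_nonneg (α := ℝ)]

theorem eLpNorm_schwartzFourier_le {p q : ℝ≥0∞} [hpq : p.HolderConjugate q] (hp : p ≤ 2)
    (φ : 𝓢(Rn n, ℂ)) : eLpNorm (schwartzFourier n φ) q volume ≤ eLpNorm φ p volume := by
  have hq : (1 / q).toReal ≤ 1 / 2 := by
    rw [one_div, ← ENNReal.HolderConjugate.one_sub_inv p q]
    calc (1 - p⁻¹).toReal ≤ ((1 : ℝ≥0∞) - 2⁻¹).toReal :=
          ENNReal.toReal_mono (by simp) (tsub_le_tsub_left (ENNReal.inv_le_inv.2 hp) 1)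
      _ = 1 / 2 := by simp [ENNReal.one_sub_inv_two]
  rw [coe_schwartzFourier, eLpNorm_const_smul, eLpNorm_comp_smul (by positivity), ← mul_assoc]
  simp only [finrank_euclideanSpace, Fintype.card_fin, inv_pow, inv_inv]
  rw [abs_of_pos (by positivity)]
  exact mul_le_of_le_one_of_le (enorm_normFactor_mul_rpow_le_one hq)
    (eLpNorm_fourier_schwartzMap_le hp φ)

theorem norm_toLp_schwartzFourier_le {p q : ℝ≥0∞} [p.HolderConjugate q] (hp : p ≤ 2)
    (φ : 𝓢(Rn n, ℂ)) :
    ‖(schwartzFourier n φ).toLp q‖ ≤ ‖φ.toLp p‖ := by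
  rw [SchwartzMap.norm_toLp, SchwartzMap.norm_toLp]
  exact ENNReal.toReal_mono (φ.memLp p volume).2.ne (eLpNorm_schwartzFourier_le hp φ)

theorem integral_schwartzFourier_mul_eq (φ ψ : 𝓢(Rn n, ℂ)) :
    ∫ ξ, schwartzFourier n φ ξ * ψ ξ = ∫ x, schwartzFourier n ψ x * φ x := by
  simp only [coe_schwartzFourier, Pi.smul_apply, smul_eq_mul, mul_assoc, integral_const_mul]
  rw [integral_fourier_smul_mul_eq φ.integrable ψ.integrable]

theorem toTemperedDistribution_toLp_apply {p : ℝ≥0∞} [Fact (1 ≤ p)] (φ ψ : 𝓢(Rn n, ℂ)) :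
    Lp.toTemperedDistribution (φ.toLp p volume) ψ = ∫ x, ψ x * φ x := by
  rw [Lp.toTemperedDistribution_apply]
  refine integral_congr_ae ?_
  filter_upwards [φ.coeFn_toLp p volume] with x hx
  rw [hx, smul_eq_mul]

theorem fourier_toTemperedDistribution_toLp {p q : ℝ≥0∞} [Fact (1 ≤ p)] [Fact (1 ≤ q)]
    (φ : 𝓢(Rn n, ℂ)) : fourier n (Lp.toTemperedDistribution (φ.toLp p)) =
      Lp.toTemperedDistribution ((schwartzFourier n φ).toLp q) := by
  ext ψ
  rw [fourier_apply, toTemperedDistribution_toLp_apply, toTemperedDistribution_toLp_apply,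
    integral_schwartzFourier_mul_eq]
  simp only [mul_comm]

theorem exists_fourier_toTemperedDistribution_eq {p q : ℝ≥0∞} [Fact (1 ≤ p)] [Fact (1 ≤ q)]
    [p.HolderConjugate q] (hp : p ≤ 2) (v : Lp ℂ p (volume : Measure (Rn n))) :
    ∃ w : Lp ℂ q (volume : Measure (Rn n)), ‖w‖ ≤ ‖v‖ ∧
      fourier n (Lp.toTemperedDistribution v) = Lp.toTemperedDistribution w := by
  set S : 𝓢(Rn n, ℂ) →ₗ[ℂ] Lp ℂ q (volume : Measure (Rn n)) :=
    (SchwartzMap.toLpCLM ℂ ℂ q volume ∘L schwartzFourier n).toLinearMap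
  set ι : 𝓢(Rn n, ℂ) →ₗ[ℂ] Lp ℂ p (volume : Measure (Rn n)) :=
    (SchwartzMap.toLpCLM ℂ ℂ p volume).toLinearMap
  have hdense : DenseRange ι :=
    SchwartzMap.denseRange_toLpCLM (hp.trans_lt ENNReal.ofNat_lt_top).ne
  have hbound (φ) : ‖S φ‖ ≤ 1 * ‖ι φ‖ := by
    rw [one_mul]
    exact norm_toLp_schwartzFourier_le hp φ
  refine ⟨S.extendOfNorm ι v, ?_, ?_⟩
  · simpa using LinearMap.norm_extendOfNorm_apply_le hdense 1 hbound v
  · refine hdense.induction_on (p := fun v => fourier n (Lp.toTemperedDistribution v) =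
      Lp.toTemperedDistribution (S.extendOfNorm ι v)) v (isClosed_eq ?_ ?_) fun φ => ?_
    · exact (fourier n ∘L Lp.toTemperedDistributionCLM ℂ volume p).continuous
    · exact (Lp.toTemperedDistributionCLM ℂ volume q ∘L S.extendOfNorm ι).continuous
    · rw [LinearMap.extendOfNorm_eq hdense ⟨1, hbound⟩]
      exact fourier_toTemperedDistribution_toLp φ

theorem holderConjugate_div_sub_one {p : ℝ≥0∞} (hp1 : 1 ≤ p) (hp : p ≠ ∞) :
    p.HolderConjugate (p / (p - 1)) := by
  rw [ENNReal.isConjExponent_iff_eq_conjExponent hp1]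
  rcases hp1.eq_or_lt with rfl | h
  · simp
  · have h0 : p - 1 ≠ 0 := by simpa [tsub_eq_zero_iff_le] using h
    have ht : p - 1 ≠ ∞ := ENNReal.sub_ne_top hp
    nth_rewrite 1 [← tsub_add_cancel_of_le hp1]
    rw [ENNReal.add_div, ENNReal.div_self h0 ht, one_div]

theorem IsLp.fourier {p q : ℝ≥0∞} [hpq : p.HolderConjugate q] (hp : p ≤ 2) {u : 𝓢'(Rn n, ℂ)}
    (hu : IsLp p u) :
    IsLp q (fourier n u) ∧ lpNorm q (FourierPhase.fourier n u) ≤ lpNorm p u := by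
  have : Fact (1 ≤ p) := ⟨ENNReal.HolderConjugate.one_le p q⟩
  have : Fact (1 ≤ q) := ⟨ENNReal.HolderConjugate.one_le q p⟩
  obtain ⟨v, rfl⟩ := hu.exists_eq_toTemperedDistribution
  obtain ⟨w, hw, hvw⟩ := exists_fourier_toTemperedDistribution_eq (q := q) hp v
  rw [hvw, lpNorm_toTemperedDistribution, lpNorm_toTemperedDistribution]
  exact ⟨isLp_toTemperedDistribution w, enorm_le_iff_norm_le.2 hw⟩

/-! ### The constant `c_{n,p}` -/

theorem fourierConst_le_one {p : ℝ≥0∞} (hp₁ : 1 ≤ p) (hp₂ : p ≤ 2) : fourierConst n p ≤ 1 := by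
  have := holderConjugate_div_sub_one hp₁ (hp₂.trans_lt ENNReal.ofNat_lt_top).ne
  refine pow_le_one₀ zero_le (sInf_le fun u hu => ?_)
  rw [one_mul]
  exact (hu.fourier hp₂).2

theorem IsLp.lpNorm_fourier_sq_le {p : ℝ≥0∞} (hp₁ : 1 ≤ p) (hp₂ : p ≤ 2) {u : 𝓢'(Rn n, ℂ)}
    (hu : IsLp p u) :
    lpNorm (p / (p - 1)) (FourierPhase.fourier n u) ^ 2 ≤ fourierConst n p * lpNorm p u ^ 2 := by
  have := holderConjugate_div_sub_one hp₁ (hp₂.trans_lt ENNReal.ofNat_lt_top).ne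
  rw [fourierConst, ← mul_pow]
  gcongr
  by_cases h₀ : lpNorm p u = 0
  · simpa only [h₀, mul_zero] using (hu.fourier (q := p / (p - 1)) hp₂).2
  · have hdiv (C : ℝ≥0∞) := ENNReal.div_le_iff_le_mul (b := lpNorm p u)
      (a := lpNorm (p / (p - 1)) (FourierPhase.fourier n u)) (c := C) (Or.inl h₀)
      (Or.inl (isLp_iff_lpNorm_ne_top.1 hu))
    exact (hdiv _).1 (le_sInf fun C hC => (hdiv C).2 (hC u hu))

theorem exists_schwartzMap_ne_zero : ∃ φ : 𝓢(Rn n, ℂ), φ ≠ 0 := by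
  let b : ContDiffBump (0 : Rn n) := ⟨1, 2, one_pos, one_lt_two⟩
  have hb : HasCompactSupport (fun x => (b x : ℂ)) :=
    b.hasCompactSupport.comp_left (g := Complex.ofReal) rfl
  refine ⟨hb.toSchwartzMap (Complex.ofRealCLM.contDiff.comp b.contDiff), fun h => ?_⟩
  have hb₀ : (b 0 : ℂ) = 0 := DFunLike.congr_fun h 0
  simp [b.one_of_mem_closedBall (x := 0) (by simp [b])] at hb₀

theorem lpNorm_fourier_toTemperedDistribution_toLp_ne_zero {p q : ℝ≥0∞} [Fact (1 ≤ p)]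
    [Fact (1 ≤ q)] {φ : 𝓢(Rn n, ℂ)} (hφ : φ ≠ 0) :
    lpNorm q (fourier n (Lp.toTemperedDistribution (φ.toLp p))) ≠ 0 := by
  rw [fourier_toTemperedDistribution_toLp (q := q), lpNorm_toTemperedDistribution, enorm_ne_zero]
  refine fun h => hφ ?_
  have h₀ : schwartzFourier n φ = 0 :=
    SchwartzMap.injective_toLp q volume (h.trans (map_zero (SchwartzMap.toLpCLM ℂ ℂ q volume)).symm)
  rw [← schwartzFourierInv_schwartzFourier φ, h₀, map_zero]

theorem fourierConst_ne_zero {p : ℝ≥0∞} (hp₁ : 1 ≤ p) (hp₂ : p ≤ 2) : fourierConst n p ≠ 0 := by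
  have := holderConjugate_div_sub_one hp₁ (hp₂.trans_lt ENNReal.ofNat_lt_top).ne
  have : Fact (1 ≤ p) := ⟨hp₁⟩
  have : Fact (1 ≤ p / (p - 1)) := ⟨ENNReal.HolderConjugate.one_le _ p⟩
  obtain ⟨φ, hφ⟩ := exists_schwartzMap_ne_zero (n := n)
  intro hC
  have h := (isLp_toTemperedDistribution (φ.toLp p)).lpNorm_fourier_sq_le hp₁ hp₂
  rw [hC, zero_mul, nonpos_iff_eq_zero, pow_eq_zero_iff two_ne_zero] at h
  exact lpNorm_fourier_toTemperedDistribution_toLp_ne_zero hφ h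

theorem lpNorm_fourier_sq_le {p : ℝ≥0∞} (hp₁ : 1 ≤ p) (hp₂ : p ≤ 2) (u : 𝓢'(Rn n, ℂ)) :
    lpNorm (p / (p - 1)) (fourier n u) ^ 2 ≤ fourierConst n p * lpNorm p u ^ 2 := by
  by_cases hu : IsLp p u
  · exact hu.lpNorm_fourier_sq_le hp₁ hp₂
  · rw [not_not.1 (mt isLp_iff_lpNorm_ne_top.2 hu), ENNReal.top_pow two_ne_zero,
      ENNReal.mul_top (fourierConst_ne_zero hp₁ hp₂)]
    exact le_top

/-! ### Powers of the bracket -/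

theorem one_le_bracket (ξ : Rn n) : 1 ≤ bracket ξ := by
  rw [bracket, Real.one_le_sqrt]
  exact le_add_of_nonneg_right (sq_nonneg _)

theorem bracket_pos (ξ : Rn n) : 0 < bracket ξ := one_pos.trans_le (one_le_bracket ξ)

theorem continuous_bracket_rpow (t : ℝ) : Continuous fun ξ : Rn n => bracket ξ ^ t := by
  simp only [bracket_rpow]
  exact (by fun_prop : Continuous fun ξ : Rn n => 1 + ‖ξ‖ ^ 2).rpow_const
    fun ξ => Or.inl (by positivity)

theorem IsRepresentedBy.bracketMul {u : 𝓢'(Rn n, ℂ)} {v : Rn n → ℂ} (h : IsRepresentedBy u v)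
    (t : ℝ) :
    IsRepresentedBy (bracketMul n t u) (fun ξ => ((bracket ξ ^ t : ℝ) : ℂ) * v ξ) := by
  refine ⟨h.1.smul_continuous (Complex.continuous_ofReal.comp (continuous_bracket_rpow t))
    |>.congr (ae_of_all _ fun ξ => mul_comm _ _), fun φ => ?_⟩
  set ψ := SchwartzMap.smulLeftCLM ℂ (fun ξ : Rn n => ((bracket ξ ^ t : ℝ) : ℂ)) φ
  have hψ : (fun ξ => ψ ξ * v ξ) = fun ξ => φ ξ * (((bracket ξ ^ t : ℝ) : ℂ) * v ξ) := by
    ext ξ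
    rw [SchwartzMap.smulLeftCLM_apply_apply (hasTemperateGrowth_bracket_rpow n t), smul_eq_mul]
    ring
  rw [← hψ]
  exact ⟨(h.2 ψ).1, (TemperedDistribution.smulLeftCLM_apply_apply _ _ _).trans (h.2 ψ).2⟩

theorem bracketMul_neg_bracketMul (t : ℝ) (u : 𝓢'(Rn n, ℂ)) :
    bracketMul n (-t) (bracketMul n t u) = u := by
  have hone : (fun ξ : Rn n => ((bracket ξ ^ t : ℝ) : ℂ)) *
      (fun ξ => ((bracket ξ ^ (-t) : ℝ) : ℂ)) = fun _ => 1 := by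
    ext ξ
    simp [← Complex.ofReal_mul, ← Real.rpow_add (bracket_pos ξ)]
  rw [bracketMul, bracketMul, TemperedDistribution.smulLeftCLM_smulLeftCLM_apply
    (hasTemperateGrowth_bracket_rpow n t) (hasTemperateGrowth_bracket_rpow n (-t))]
  simp [hone, TemperedDistribution.smulLeftCLM_const]

/-! ### Fourier transforms of elements of `H^s` -/

variable {s : ℝ}

theorem isRepresentedBy_hat {u : 𝓢'(Rn n, ℂ)} {v : Rn n → ℂ}
    (h : IsRepresentedBy (fourier n u) v) : IsRepresentedBy (fourier n u) (hat u) := by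
  have hu : ∃ v, IsRepresentedBy (fourier n u) v := ⟨v, h⟩
  rw [hat, dif_pos hu]
  exact hu.choose_spec

theorem Hs.isLp_bracketMul_fourier (f : Hs n s) : IsLp 2 (bracketMul n s (fourier n f.1)) := by
  have hf : IsLp 2 (fourierInv n (bracketMul n s (fourier n f.1))) := f.2
  simpa only [fourier_fourierInv] using (hf.fourier (q := 2) le_rfl).1

theorem Hs.isRepresentedBy_hat (f : Hs n s) : IsRepresentedBy (fourier n f.1) (hat f.1) := by
  obtain ⟨w, hw, -⟩ := Hs.isLp_bracketMul_fourier f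
  have h := hw.bracketMul (-s)
  rw [bracketMul_neg_bracketMul] at h
  exact FourierPhase.isRepresentedBy_hat h

/-- The function `⟨·⟩^t û`, the Fourier transform of the Bessel potential of order `t` of a
tempered distribution `u` whose Fourier transform is a function. -/
def bracketHat (t : ℝ) (u : 𝓢'(Rn n, ℂ)) (ξ : Rn n) : ℂ :=
  ((bracket ξ ^ t : ℝ) : ℂ) * hat u ξ

theorem bracketHat_eq_bracket_rpow_mul (s t : ℝ) (u : 𝓢'(Rn n, ℂ)) :
    bracketHat s u = fun ξ => ((bracket ξ ^ (s - t) : ℝ) : ℂ) * bracketHat t u ξ := by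
  ext ξ
  rw [bracketHat, bracketHat, ← mul_assoc, ← Complex.ofReal_mul, ← Real.rpow_add (bracket_pos ξ),
    sub_add_cancel]

theorem Hs.isRepresentedBy_bracketHat (f : Hs n s) (t : ℝ) :
    IsRepresentedBy (bracketMul n t (fourier n f.1)) (bracketHat t f.1) :=
  (Hs.isRepresentedBy_hat f).bracketMul t

theorem Hs.aestronglyMeasurable_bracketHat (f : Hs n s) (t : ℝ) :
    AEStronglyMeasurable (bracketHat t f.1) volume :=
  (Hs.isRepresentedBy_bracketHat f t).1.aestronglyMeasurable

theorem Hs.sobolevNorm_eq (f : Hs n s) :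
    sobolevNorm s f.1 = eLpNorm (bracketHat s f.1) 2 volume :=
  (Hs.isRepresentedBy_bracketHat f s).lpNorm_eq 2

theorem Hs.memLp_bracketHat (f : Hs n s) : MemLp (bracketHat s f.1) 2 volume := by
  obtain ⟨w, hw, hw₂⟩ := Hs.isLp_bracketMul_fourier f
  exact hw₂.ae_eq (hw.ae_eq (Hs.isRepresentedBy_bracketHat f s))

theorem Hs.eLpNorm_bracketHat_sq_le {p : ℝ≥0∞} (hp₁ : 1 ≤ p) (hp₂ : p ≤ 2) (f : Hs n s) (t : ℝ) :
    eLpNorm (bracketHat t f.1) (p / (p - 1)) volume ^ 2 ≤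
      fourierConst n p * besselNorm t p f.1 ^ 2 := by
  rw [← (Hs.isRepresentedBy_bracketHat f t).lpNorm_eq, besselNorm]
  nth_rewrite 1 [← fourier_fourierInv (bracketMul n t (fourier n f.1))]
  exact lpNorm_fourier_sq_le hp₁ hp₂ _

theorem Hs.hat_sub (f g : Hs n s) : hat (f - g : Hs n s).1 =ᵐ[volume] hat f.1 - hat g.1 := by
  have h := (Hs.isRepresentedBy_hat f).add ((Hs.isRepresentedBy_hat g).smul (-1))
  rw [neg_one_smul ℂ (hat g.1), neg_one_smul ℂ (fourier n g.1), ← sub_eq_add_neg,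
    ← sub_eq_add_neg, ← map_sub] at h
  exact (Hs.isRepresentedBy_hat (f - g)).ae_eq h

/-! ### The phase group -/

theorem norm_bracketHat_apply_eq {P : Equiv.Perm (Hs n s)} (hP : P ∈ phaseGroup n s)
    (f : Hs n s) (t : ℝ) :
    ∀ᵐ ξ : Rn n, ‖bracketHat t (P f).1 ξ‖ = ‖bracketHat t f.1 ξ‖ := by
  filter_upwards [hP.2 f] with ξ hξ
  rw [bracketHat, bracketHat, norm_mul, norm_mul, hξ]

theorem norm_bracketHat_sub_le {P Q : Equiv.Perm (Hs n s)} (hP : P ∈ phaseGroup n s)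
    (hQ : Q ∈ phaseGroup n s) (f g : Hs n s) (t : ℝ) :
    ∀ᵐ ξ : Rn n, ‖bracketHat t (P f - Q g : Hs n s).1 ξ‖ ≤
      ‖bracketHat t f.1 ξ‖ + ‖bracketHat t g.1 ξ‖ := by
  filter_upwards [Hs.hat_sub (P f) (Q g), norm_bracketHat_apply_eq hP f t,
    norm_bracketHat_apply_eq hQ g t] with ξ hsub hf hg
  rw [← hf, ← hg, bracketHat, hsub, Pi.sub_apply, mul_sub]
  exact norm_sub_le _ _

theorem sobolevNorm_apply_eq {P : Equiv.Perm (Hs n s)} (hP : P ∈ phaseGroup n s) (f : Hs n s) :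
    sobolevNorm s (P f).1 = sobolevNorm s f.1 := by
  rw [Hs.sobolevNorm_eq, Hs.sobolevNorm_eq]
  exact eLpNorm_congr_norm_ae (norm_bracketHat_apply_eq hP f s)

theorem quotDist_le_sobolevNorm {G : Subgroup (Equiv.Perm (Hs n s))} (hG : G ≤ phaseGroup n s)
    (f g : Hs n s) {P Q : Equiv.Perm (Hs n s)} (hP : P ∈ G) (hQ : Q ∈ G) :
    quotDist G f g ≤ sobolevNorm s (P f - Q g : Hs n s).1 := by
  have hPsub : P (f - (P⁻¹ * Q) g) = P f - Q g := by
    rw [eq_sub_iff_add_eq]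
    simpa using ((hG hP).1 (f - (P⁻¹ * Q) g) ((P⁻¹ * Q) g)).symm
  rw [← hPsub, sobolevNorm_apply_eq (hG hP)]
  exact iInf₂_le (P⁻¹ * Q) (G.mul_mem (G.inv_mem hP) hQ)

/-! ### The estimate for a pair of group elements -/

theorem measurableSet_suppInter (f g : 𝓢'(Rn n, ℂ)) : MeasurableSet (suppInter f g) :=
  ((isClosed_dsupport _).inter (isClosed_dsupport _)).measurableSet

theorem norm_hat_sub_eq_of_notMem_suppInter {P Q : Equiv.Perm (Hs n s)}
    (hP : P ∈ phaseGroup n s) (hQ : Q ∈ phaseGroup n s) (f g : Hs n s) :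
    ∀ᵐ ξ : Rn n, ξ ∉ suppInter f.1 g.1 →
      ‖hat (P f - Q g : Hs n s).1 ξ‖ = ‖‖hat f.1 ξ‖ - ‖hat g.1 ξ‖‖ := by
  filter_upwards [Hs.hat_sub (P f) (Q g), hP.2 f, hQ.2 g,
    (Hs.isRepresentedBy_hat f).ae_eq_zero_of_notMem_dsupport,
    (Hs.isRepresentedBy_hat g).ae_eq_zero_of_notMem_dsupport] with ξ hsub hPf hQg hf hg hξ
  rw [suppInter, Set.mem_inter_iff, not_and_or] at hξ
  rw [hsub, Pi.sub_apply, hPf, hQg]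
  rcases hξ.imp hf hg with h | h
  · have hPf₀ : hat (P f).1 ξ = 0 := by rw [← norm_eq_zero, ← hPf, h, norm_zero]
    simp [hPf₀]
  · have hQg₀ : hat (Q g).1 ξ = 0 := by rw [← norm_eq_zero, ← hQg, h, norm_zero]
    simp [hQg₀]

theorem eLpNorm_two_sq {α E : Type*} [MeasurableSpace α] {μ : Measure α} [NormedAddCommGroup E]
    (F : α → E) : eLpNorm F 2 μ ^ 2 = ∫⁻ ξ, ‖F ξ‖ₑ ^ 2 ∂μ := by
  simpa using eLpNorm_nnreal_pow_eq_lintegral (f := F) (μ := μ) (two_ne_zero (α := NNReal))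

theorem holderTriple_div_two_sub {p : ℝ≥0∞} (hp₁ : 1 ≤ p) (hp₂ : p ≤ 2) :
    (p / (2 - p)).HolderTriple (p / (p - 1) / 2) 1 := by
  have hpt : p ≠ ∞ := (hp₂.trans_lt ENNReal.ofNat_lt_top).ne
  have hp₀ : p ≠ 0 := (one_pos.trans_le hp₁).ne'
  have hsum : 2 - p + (p - 1) * 2 = p := by
    lift p to NNReal using hpt
    norm_cast at hp₁ hp₂ ⊢
    ext
    push_cast [NNReal.coe_sub hp₂, NNReal.coe_sub hp₁]
    ring
  refine ⟨?_⟩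
  rw [ENNReal.inv_div (Or.inr hpt) (Or.inr hp₀), ENNReal.inv_div (by simp) (by simp),
    div_eq_mul_inv 2, ENNReal.inv_div (Or.inr hpt) (Or.inr hp₀), mul_comm 2,
    ← ENNReal.mul_div_right_comm, ENNReal.div_add_div_same, hsum, ENNReal.div_self hp₀ hpt, inv_one]

theorem setLIntegral_enorm_bracket_rpow_mul_sq_le {p : ℝ≥0∞} (hp₁ : 1 ≤ p) (hp₂ : p ≤ 2)
    (s t : ℝ) {A : Set (Rn n)} (hA : MeasurableSet A) {F : Rn n → ℂ}
    (hF : AEStronglyMeasurable F volume) :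
    ∫⁻ ξ in A, ‖((bracket ξ ^ (s - t) : ℝ) : ℂ) * F ξ‖ₑ ^ 2 ≤
      weightConst A s t p * eLpNorm F (p / (p - 1)) volume ^ 2 := by
  have := holderTriple_div_two_sub hp₁ hp₂
  set w : Rn n → ℝ := A.indicator fun ξ => bracket ξ ^ (2 * s - 2 * t)
  have hw : AEStronglyMeasurable w volume :=
    ((continuous_bracket_rpow _).measurable.indicator hA).aestronglyMeasurable
  have hF₂ : AEStronglyMeasurable (fun ξ => ‖F ξ‖ ^ (2 : ℝ)) volume :=
    (hF.norm.aemeasurable.pow_const 2).aestronglyMeasurable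
  have hpoint (ξ : Rn n) : A.indicator (fun ξ => ‖((bracket ξ ^ (s - t) : ℝ) : ℂ) * F ξ‖ₑ ^ 2) ξ =
      ‖(w • fun ξ => ‖F ξ‖ ^ (2 : ℝ)) ξ‖ₑ := by
    by_cases hξ : ξ ∈ A
    · have hpow : bracket ξ ^ (2 * s - 2 * t) = (bracket ξ ^ (s - t)) ^ 2 := by
        rw [← Real.rpow_mul_natCast (bracket_pos ξ).le]
        congr 1
        push_cast
        ring
      have hreal : ‖((bracket ξ ^ (s - t) : ℝ) : ℂ)‖ₑ = ‖bracket ξ ^ (s - t)‖ₑ :=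
        enorm_eq_iff_norm_eq.2 (Complex.norm_real _)
      simp [w, hξ, hpow, hreal, mul_pow, enorm_mul]
    · simp [w, hξ]
  calc ∫⁻ ξ in A, ‖((bracket ξ ^ (s - t) : ℝ) : ℂ) * F ξ‖ₑ ^ 2
      = eLpNorm (w • fun ξ => ‖F ξ‖ ^ (2 : ℝ)) 1 volume := by
        rw [← lintegral_indicator hA, eLpNorm_one_eq_lintegral_enorm]
        exact lintegral_congr hpoint
    _ ≤ eLpNorm w (p / (2 - p)) volume *
          eLpNorm (fun ξ => ‖F ξ‖ ^ (2 : ℝ)) (p / (p - 1) / 2) volume :=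
        eLpNorm_smul_le_mul_eLpNorm hF₂ hw
    _ = weightConst A s t p * eLpNorm F (p / (p - 1)) volume ^ 2 := by
        rw [eLpNorm_norm_rpow _ two_pos, ENNReal.ofReal_ofNat,
          ENNReal.div_mul_cancel two_ne_zero ENNReal.ofNat_ne_top, ENNReal.rpow_two, weightConst]

theorem quotDist_sq_le {p : ℝ≥0∞} (hp₁ : 1 ≤ p) (hp₂ : p ≤ 2) (t : ℝ)
    {G : Subgroup (Equiv.Perm (Hs n s))} (hG : G ≤ phaseGroup n s)
    (f g : Hs n s) {P Q : Equiv.Perm (Hs n s)} (hP : P ∈ G) (hQ : Q ∈ G) :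
    quotDist G f g ^ 2 ≤
      eLpNorm (fun ξ : Rn n => bracket ξ ^ s * (‖hat f.1 ξ‖ - ‖hat g.1 ξ‖)) 2 volume ^ 2 +
      fourierConst n p * weightConst (suppInter f.1 g.1) s t p *
        besselNorm t p (P f - Q g : Hs n s).1 ^ 2 := by
  set A := suppInter f.1 g.1
  have hA : MeasurableSet A := measurableSet_suppInter f.1 g.1
  set h : Hs n s := P f - Q g
  have hoff : ∫⁻ ξ in Aᶜ, ‖bracketHat s h.1 ξ‖ₑ ^ 2 ≤
      ∫⁻ ξ, ‖bracket ξ ^ s * (‖hat f.1 ξ‖ - ‖hat g.1 ξ‖)‖ₑ ^ 2 := by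
    refine le_trans (setLIntegral_mono_ae' hA.compl ?_) (setLIntegral_le_lintegral Aᶜ _)
    filter_upwards [norm_hat_sub_eq_of_notMem_suppInter (hG hP) (hG hQ) f g] with ξ hξ hξA
    rw [bracketHat, ← ofReal_norm, ← ofReal_norm, norm_mul, norm_mul, Complex.norm_real,
      hξ hξA]
  have hon : ∫⁻ ξ in A, ‖bracketHat s h.1 ξ‖ₑ ^ 2 ≤
      fourierConst n p * weightConst A s t p * besselNorm t p h.1 ^ 2 := by
    rw [bracketHat_eq_bracket_rpow_mul s t, mul_comm (fourierConst n p), mul_assoc]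
    refine (setLIntegral_enorm_bracket_rpow_mul_sq_le hp₁ hp₂ s t hA
      (Hs.aestronglyMeasurable_bracketHat h t)).trans ?_
    gcongr
    exact Hs.eLpNorm_bracketHat_sq_le hp₁ hp₂ h t
  calc quotDist G f g ^ 2 ≤ eLpNorm (bracketHat s h.1) 2 volume ^ 2 := by
        rw [← Hs.sobolevNorm_eq]
        gcongr
        exact quotDist_le_sobolevNorm hG f g hP hQ
    _ = (∫⁻ ξ in Aᶜ, ‖bracketHat s h.1 ξ‖ₑ ^ 2) + ∫⁻ ξ in A, ‖bracketHat s h.1 ξ‖ₑ ^ 2 := by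
        rw [eLpNorm_two_sq, add_comm, lintegral_add_compl _ hA]
    _ ≤ _ := by
        rw [eLpNorm_two_sq]
        exact add_le_add hoff hon

/-! ### The infimum over pairs of group elements -/

theorem tendsto_zero_of_tendsto_pow_zero {α : Type*} {l : Filter α} {u : α → ℝ≥0∞} {k : ℕ}
    (hk : k ≠ 0) (h : Filter.Tendsto (fun i => u i ^ k) l (nhds 0)) :
    Filter.Tendsto u l (nhds 0) := by
  have hroot := h.ennrpow_const (k : ℝ)⁻¹
  rw [ENNReal.zero_rpow_of_pos (by positivity)] at hroot
  exact hroot.congr fun i => ENNReal.pow_rpow_inv_natCast hk (u i)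

theorem exists_strictMono_tendsto_eLpNorm_mul_zero {α R : Type*} [MeasurableSpace α]
    [NormedRing R] {μ : Measure α} {q : ℝ≥0∞} (hq : q ≠ 0) {F : ℕ → α → R} {w : α → R} {b : α → ℝ}
    (hF : ∀ k, AEStronglyMeasurable (F k) μ) (hw : AEStronglyMeasurable w μ) (hb : MemLp b 2 μ)
    (hlim : Filter.Tendsto (fun k => eLpNorm (F k) q μ) Filter.atTop (nhds 0))
    (hdom : ∀ k, ∀ᵐ x ∂μ, ‖w x * F k x‖ ≤ b x) :
    ∃ ns : ℕ → ℕ, StrictMono ns ∧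
      Filter.Tendsto (fun i => eLpNorm (fun x => w x * F (ns i) x) 2 μ) Filter.atTop (nhds 0) := by
  obtain ⟨ns, hns, hae⟩ := (tendstoInMeasure_of_tendsto_eLpNorm hq hF aestronglyMeasurable_zero
    (by simpa only [sub_zero] using hlim)).exists_seq_tendsto_ae
  refine ⟨ns, hns, tendsto_zero_of_tendsto_pow_zero two_ne_zero ?_⟩
  simp only [eLpNorm_two_sq]
  rw [← lintegral_zero (μ := μ)]
  refine tendsto_lintegral_of_dominated_convergence' (fun x => ‖b x‖ₑ ^ 2)
    (fun i => (hw.mul (hF (ns i))).enorm.pow_const 2) (fun i => ?_) ?_ ?_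
  · filter_upwards [hdom (ns i)] with x hx
    gcongr
    exact enorm_le_iff_norm_le.2 (hx.trans (le_abs_self _))
  · rw [← eLpNorm_two_sq]
    exact ENNReal.pow_ne_top hb.2.ne
  · filter_upwards [hae] with x hx
    simpa using ENNReal.Tendsto.pow (n := 2) (hx.const_mul (w x)).enorm

theorem quotDist_eq_zero_of_tendsto {t : ℝ} {q : ℝ≥0∞} (hq : q ≠ 0)
    {G : Subgroup (Equiv.Perm (Hs n s))} (hG : G ≤ phaseGroup n s) (f g : Hs n s)
    {P Q : ℕ → Equiv.Perm (Hs n s)} (hP : ∀ k, P k ∈ G) (hQ : ∀ k, Q k ∈ G)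
    (hlim : Filter.Tendsto
      (fun k => eLpNorm (bracketHat t (P k f - Q k g : Hs n s).1) q volume)
      Filter.atTop (nhds 0)) :
    quotDist G f g = 0 := by
  obtain ⟨ns, -, hns⟩ := exists_strictMono_tendsto_eLpNorm_mul_zero hq
    (w := fun ξ => ((bracket ξ ^ (s - t) : ℝ) : ℂ))
    (b := fun ξ => ‖bracketHat s f.1 ξ‖ + ‖bracketHat s g.1 ξ‖)
    (fun k => Hs.aestronglyMeasurable_bracketHat (P k f - Q k g) t)
    (Complex.continuous_ofReal.comp (continuous_bracket_rpow (s - t))).aestronglyMeasurable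
    ((Hs.memLp_bracketHat f).norm.add (Hs.memLp_bracketHat g).norm) hlim fun k => by
      simpa only [bracketHat_eq_bracket_rpow_mul s t (P k f - Q k g : Hs n s).1] using
        norm_bracketHat_sub_le (hG (hP k)) (hG (hQ k)) f g s
  refine nonpos_iff_eq_zero.1 (ge_of_tendsto' hns fun i => ?_)
  rw [← bracketHat_eq_bracket_rpow_mul, ← Hs.sobolevNorm_eq]
  exact quotDist_le_sobolevNorm hG f g (hP _) (hQ _)

theorem quotDist_eq_zero_of_iInf_eq_zero {p : ℝ≥0∞} (hp₁ : 1 ≤ p) (hp₂ : p ≤ 2) (t : ℝ)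
    {G : Subgroup (Equiv.Perm (Hs n s))} (hG : G ≤ phaseGroup n s) (f g : Hs n s)
    (h : ⨅ i : G × G, besselNorm t p (i.1.1 f - i.2.1 g : Hs n s).1 ^ 2 = 0) :
    quotDist G f g = 0 := by
  obtain ⟨u, -, hu, hmem⟩ := exists_seq_tendsto_sInf
    (Set.range_nonempty fun i : G × G => besselNorm t p (i.1.1 f - i.2.1 g : Hs n s).1 ^ 2)
    (OrderBot.bddBelow _)
  rw [sInf_range, h] at hu
  choose i hi using hmem
  have hq : p / (p - 1) ≠ 0 := ENNReal.div_ne_zero.2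
    ⟨(one_pos.trans_le hp₁).ne', ENNReal.sub_ne_top (hp₂.trans_lt ENNReal.ofNat_lt_top).ne⟩
  refine quotDist_eq_zero_of_tendsto (t := t) hq hG f g (fun k => (i k).1.2)
    (fun k => (i k).2.2) (tendsto_zero_of_tendsto_pow_zero two_ne_zero ?_)
  refine tendsto_of_tendsto_of_tendsto_of_le_of_le tendsto_const_nhds hu (fun _ => zero_le)
    fun k => ?_
  rw [← hi k]
  exact (Hs.eLpNorm_bracketHat_sq_le hp₁ hp₂ _ t).trans
    (mul_le_of_le_one_left' (fourierConst_le_one hp₁ hp₂))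

/-- Multiplication by `∞` does not commute with an infimum that is `0` without being attained. -/
theorem le_add_mul_iInf {ι : Type*} [Nonempty ι] {x a K : ℝ≥0∞} {b : ι → ℝ≥0∞}
    (h : ∀ i, x ≤ a + K * b i) (h₀ : ⨅ i, b i = 0 → x = 0) : x ≤ a + K * ⨅ i, b i := by
  by_cases hb : ⨅ i, b i = 0
  · rw [h₀ hb]
    exact zero_le
  · rw [ENNReal.mul_iInf fun _ hb₀ => absurd hb₀ hb, ENNReal.add_iInf]
    exact le_iInf h

theorem quotDist_sq_le_iInf {p : ℝ≥0∞} (hp₁ : 1 ≤ p) (hp₂ : p ≤ 2) (t : ℝ)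
    {G : Subgroup (Equiv.Perm (Hs n s))} (hG : G ≤ phaseGroup n s) (f g : Hs n s) :
    quotDist G f g ^ 2 ≤
      eLpNorm (fun ξ : Rn n => bracket ξ ^ s * (‖hat f.1 ξ‖ - ‖hat g.1 ξ‖)) 2 volume ^ 2 +
      fourierConst n p * weightConst (suppInter f.1 g.1) s t p *
        ⨅ P ∈ G, ⨅ Q ∈ G, besselNorm t p (P f - Q g : Hs n s).1 ^ 2 := by
  have hprod : (⨅ P ∈ G, ⨅ Q ∈ G, besselNorm t p (P f - Q g : Hs n s).1 ^ 2) =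
      ⨅ i : G × G, besselNorm t p (i.1.1 f - i.2.1 g : Hs n s).1 ^ 2 := by
    simp only [iInf_prod, iInf_subtype]
  rw [hprod]
  refine le_add_mul_iInf (fun i => quotDist_sq_le hp₁ hp₂ t hG f g i.1.2 i.2.2) fun h => ?_
  rw [quotDist_eq_zero_of_iInf_eq_zero hp₁ hp₂ t hG f g h, zero_pow two_ne_zero]

/-! ### Finiteness of the weight constant -/

theorem norm_bracket_rpow_le_one {r : ℝ} (hr : r ≤ 0) (ξ : Rn n) : ‖bracket ξ ^ r‖ ≤ 1 := by
  rw [Real.norm_of_nonneg (Real.rpow_nonneg (bracket_pos ξ).le _)]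
  exact Real.rpow_le_one_of_one_le_of_nonpos (one_le_bracket ξ) hr

theorem memLp_top_bracket_rpow {r : ℝ} (hr : r ≤ 0) :
    MemLp (fun ξ : Rn n => bracket ξ ^ r) ∞ volume :=
  memLp_top_of_bound (continuous_bracket_rpow r).aestronglyMeasurable 1
    (ae_of_all _ (norm_bracket_rpow_le_one hr))

theorem memLp_bracket_rpow {q : ℝ≥0∞} (hq₀ : q ≠ 0) (hq : q ≠ ∞) {r : ℝ}
    (hr : n < -r * q.toReal) : MemLp (fun ξ : Rn n => bracket ξ ^ r) q volume := by
  rw [← integrable_norm_rpow_iff (continuous_bracket_rpow r).aestronglyMeasurable hq₀ hq]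
  refine (integrable_rpow_neg_one_add_norm_sq (E := Rn n) (by simpa using hr)).congr
    (ae_of_all _ fun ξ => ?_)
  simp only
  rw [Real.norm_of_nonneg (Real.rpow_nonneg (bracket_pos ξ).le r),
    ← Real.rpow_mul (bracket_pos ξ).le, bracket_rpow]
  congr 1
  ring

theorem weightConst_lt_top_of_bound {A : Set (Rn n)} (hA : MeasurableSet A) (hv : volume A < ∞)
    {s t : ℝ} {p : ℝ≥0∞} {C : ℝ} (hC : ∀ ξ ∈ A, ‖bracket ξ ^ (2 * s - 2 * t)‖ ≤ C) :
    weightConst A s t p < ∞ := by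
  have : IsFiniteMeasure (volume.restrict A) := isFiniteMeasure_restrict.2 hv.ne
  rw [weightConst, eLpNorm_indicator_eq_eLpNorm_restrict hA]
  exact (MemLp.of_bound (continuous_bracket_rpow _).aestronglyMeasurable C
    ((ae_restrict_iff' hA).2 (ae_of_all _ hC))).2

theorem weightConst_lt_top_of_isCompact {A : Set (Rn n)} (hA : IsCompact A) (s t : ℝ)
    (p : ℝ≥0∞) : weightConst A s t p < ∞ :=
  have ⟨_, hC⟩ := hA.exists_bound_of_continuousOn
    (continuous_bracket_rpow (2 * s - 2 * t)).continuousOn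
  weightConst_lt_top_of_bound hA.measurableSet hA.measure_lt_top hC

theorem weightConst_lt_top_of_volume_lt_top {A : Set (Rn n)} (hA : MeasurableSet A)
    (hv : volume A < ∞) {s t : ℝ} (hst : s ≤ t) (p : ℝ≥0∞) : weightConst A s t p < ∞ :=
  weightConst_lt_top_of_bound hA hv fun ξ _ => norm_bracket_rpow_le_one (by linarith) ξ

theorem weightConst_lt_top_of_lt {p : ℝ≥0∞} (hp₁ : 1 ≤ p) (hp₂ : p ≤ 2) (A : Set (Rn n))
    {s t : ℝ} (h : s < t - n * (1 / p.toReal - 1 / 2)) : weightConst A s t p < ∞ := by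
  refine (eLpNorm_indicator_le _).trans_lt (MemLp.eLpNorm_lt_top ?_)
  rcases hp₂.eq_or_lt with rfl | hlt
  · rw [tsub_self, ENNReal.div_zero two_ne_zero]
    refine memLp_top_bracket_rpow ?_
    norm_num at h
    linarith
  have hpt : p ≠ ∞ := hlt.ne_top
  have hp₀ : p ≠ 0 := (one_pos.trans_le hp₁).ne'
  have hpos : 0 < p.toReal := ENNReal.toReal_pos hp₀ hpt
  have hlt_real : p.toReal < 2 := (ENNReal.toReal_lt_toReal hpt ENNReal.ofNat_ne_top).2 hlt
  refine memLp_bracket_rpow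
    (ENNReal.div_ne_zero.2 ⟨hp₀, ENNReal.sub_ne_top ENNReal.ofNat_ne_top⟩)
    (ENNReal.div_ne_top hpt (tsub_pos_of_lt hlt).ne') ?_
  rw [ENNReal.toReal_div, ENNReal.toReal_sub_of_le hp₂ ENNReal.ofNat_ne_top, ENNReal.toReal_ofNat]
  have hr : 0 < p.toReal / (2 - p.toReal) := div_pos hpos (sub_pos.2 hlt_real)
  calc (n : ℝ) = 2 * (n * (1 / p.toReal - 1 / 2)) * (p.toReal / (2 - p.toReal)) := by
        have : 2 - p.toReal ≠ 0 := (sub_pos.2 hlt_real).ne'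
        field_simp
    _ < -(2 * s - 2 * t) * (p.toReal / (2 - p.toReal)) :=
        mul_lt_mul_of_pos_right (by linarith) hr

end FourierPhase

end

theorem theorem1 (n : ℕ) (hn : 0 < n) (t s : ℝ) (p : ℝ≥0∞) (hp1 : 1 ≤ p) (hp2 : p ≤ 2)
    (G : Subgroup (Equiv.Perm (Hs n s))) (hG : G ≤ phaseGroup n s) (f g : Hs n s) :
    quotDist G f g ^ 2 ≤
        eLpNorm (fun ξ : Rn n => bracket ξ ^ s * (‖hat f.1 ξ‖ - ‖hat g.1 ξ‖)) 2 volume ^ 2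
        + fourierConst n p * weightConst (suppInter f.1 g.1) s t p
          * (⨅ P ∈ G, ⨅ Q ∈ G, besselNorm t p (P f - Q g : Hs n s).1 ^ 2)
      ∧ fourierConst n p ≤ 1
      ∧ (IsCompact (suppInter f.1 g.1) → weightConst (suppInter f.1 g.1) s t p < ∞)
      ∧ (volume (suppInter f.1 g.1) < ∞ → s ≤ t →
          weightConst (suppInter f.1 g.1) s t p < ∞)
      ∧ (s < t - n * (1 / p.toReal - 1 / 2) →
          weightConst (suppInter f.1 g.1) s t p < ∞) := by
  refine ⟨?_, fourierConst_le_one hp1 hp2, ?_, ?_, ?_⟩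
  · exact quotDist_sq_le_iInf hp1 hp2 t hG f g
  · exact fun hA => weightConst_lt_top_of_isCompact hA s t p
  · exact fun hA hst => weightConst_lt_top_of_volume_lt_top (measurableSet_suppInter _ _) hA hst p
  · exact weightConst_lt_top_of_lt hp1 hp2 _
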